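/- Let $\Sigma=\{\mathbf u,\mathbf l,\mathbf d,\mathbf r\}$ be the four unit directions (up, left, down, right). For a word $Y$ over $\Sigma$, let $\widetilde Y$ be its reverse and let $\rho(Y)$ be the word obtained from $Y$ by rotating each letter by $270^\circ$ counterclockwise. A word $X$ is a palindrome if $X=\widetilde X$, and a $90$-drome if $X=Y\,\rho(\widetilde Y)$ for some word $Y$; the empty word is both. A polyomino is a simply connected polygon made of finitely many unit cells of the square grid (a finite nonempty set of cells, connected through edges, whose complement is also connected through edges). Its boundary word is the circular word over $\Sigma$ of the directions travelled in one clockwise traversal of its boundary, and its length $n$ is the number of unit edges on the boundary. A quarter-turn factorization of a circular word is a way to write some cyclic shift of it as a concatenation $ABC$ of possibly empty words with $A$ a palindrome and $B$, $C$ $90$-dromes. **Theorem.** It can be decided in $O(n)$ time whether the boundary word of a polyomino has a quarter-turn factorization, where $n$ is the length of the boundary word. That is, there are a single deterministic program for the unit-cost random access machine and constants $K,k$ such that, for every polyomino and every cyclic shift $W$ of its boundary word, with $n=|W|$, the program started on $W$ halts after at most $Kn$ steps, writes to memory only numbers less than $n^k$ and only at array indices less than $n^k$ (so that words of $O(\log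 n)$ bits suffice), and outputs $1$ if the boundary word has a quarter-turn factorization and $0$ otherwise. -/

import Mathlib

namespace QuarterTurn

/-! ### Letters and words -/

/-- The four unit directions: up, left, down, right. -/
inductive Letter
  | u | l | d | r
  deriving DecidableEq

namespace Letter

/-- Rotation of a letter by a counterclockwise quarter turn. -/
def rot90 : Letter → Letter
  | u => l
  | l => d
  | d => r
  | r => u

/-- Rotation of a letter by `k` counterclockwise quarter turns, i.e. by `90 * k` degrees. -/
def rot (k : ℕ) (x : Letter) : Letter := rot90^[k] x

/-- The displacement of a unit step in the given direction. -/
def vec : Letter → ℤ × ℤ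
  | u => (0, 1)
  | l => (-1, 0)
  | d => (0, -1)
  | r => (1, 0)

/-- The number by which a letter is presented to a machine. -/
def code : Letter → ℕ
  | u => 0
  | l => 1
  | d => 2
  | r => 3

end Letter

/-- `X` is a `θ`-drome, for `θ = 90 * k` degrees: `X = Y Z`, where `Z` is the reverse of `Y`
with every letter rotated by `θ + 180` degrees. -/
def IsDrome (k : ℕ) (X : List Letter) : Prop :=
  ∃ Y : List Letter, X = Y ++ Y.reverse.map (Letter.rot (k + 2))

/-- The circular word represented by `W` is a product `A B C` of consecutive factors
(possibly empty), with `A` a palindrome and `B`, `C` both `90`-dromes.  Factors of a circular word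
are factors of its shifts. -/
def HasQuarterTurnFactorization (W : List Letter) : Prop :=
  ∃ A B C : List Letter, W ~r (A ++ B ++ C) ∧ A.Palindrome ∧ IsDrome 1 B ∧ IsDrome 1 C

/-! ### Polyominoes and their boundary words -/

/-- The graph of unit cells of the square grid, adjacent when they share an edge.  The pair
`(x, y)` stands for the closed cell `[x, x + 1] × [y, y + 1]`. -/
def cellGraph : SimpleGraph (ℤ × ℤ) where
  Adj p q := ∃ a : Letter, q = p + a.vec
  symm := ⟨by
    rintro p q ⟨a, rfl⟩
    refine ⟨a.rot 2, ?_⟩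
    cases a <;> simp [Letter.vec, Letter.rot, Letter.rot90, Prod.ext_iff]⟩
  loopless := ⟨by
    rintro p ⟨a, h⟩
    cases a <;> simp [Letter.vec, Prod.ext_iff] at h⟩

/-- A polyomino: a finite nonempty set of unit cells that is connected through edges and has no
holes, in that the other cells are also connected through edges. The union of its cells is
a simply connected polygon with unit edges parallel to the axes. -/
structure Polyomino where
  cells : Finset (ℤ × ℤ)
  connected : (cellGraph.induce (cells : Set (ℤ × ℤ))).Connected
  compl_connected : (cellGraph.induce ((cells : Set (ℤ × ℤ))ᶜ)).Connected

/-- The cell to the right of the unit step that leaves the lattice point `p` in a direction. -/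
def rightCell (p : ℤ × ℤ) : Letter → ℤ × ℤ
  | .u => p
  | .l => p + (-1, 0)
  | .d => p + (-1, -1)
  | .r => p + (0, -1)

/-- The cell to the left of the unit step that leaves the lattice point `p` in a direction. -/
def leftCell (p : ℤ × ℤ) : Letter → ℤ × ℤ
  | .u => p + (-1, 0)
  | .l => p + (-1, -1)
  | .d => p + (0, -1)
  | .r => p

/-- The steps (starting point and direction) of the walk that starts at `p` and follows `W`. -/
def steps (p : ℤ × ℤ) : List Letter → List ((ℤ × ℤ) × Letter)
  | [] => []
  | a :: W => (p, a) :: steps (p + a.vec) W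

/-- `W` is (a shift of) the boundary word of `P`: from some lattice point, `W` traces a closed walk
that visits no point twice and whose steps are exactly the edges between a cell of `P` on the right
and a cell outside `P` on the left, so that the boundary of `P` is traversed once, clockwise. -/
def Polyomino.IsBoundaryWord (P : Polyomino) (W : List Letter) : Prop :=
  ∃ p : ℤ × ℤ,
    p + (W.map Letter.vec).sum = p ∧
    ((steps p W).map Prod.fst).Nodup ∧
    ∀ (q : ℤ × ℤ) (a : Letter),
      (q, a) ∈ steps p W ↔ rightCell q a ∈ P.cells ∧ leftCell q a ∉ P.cells

/-! ### Random access machines with unit cost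

A program uses finitely many registers and finitely many arrays.  Every elementary operation takes
one step: reading a constant or a register, reading or writing an array entry at a computed
index, an arithmetic operation, a comparison, an assignment, a branching. -/

/-- The contents of the memory: registers, and arrays with their entries. -/
structure Memory where
  reg : ℕ → ℕ
  arr : ℕ → ℕ → ℕ

/-- The binary operations: sum, truncated difference, product, quotient rounded down, and the tests
`<` and `=`, with result `1` or `0`. -/
inductive Op
  | add | sub | mul | div | lt | eq

/-- The value of a binary operation. -/
def Op.eval : Op → ℕ → ℕ → ℕ
  | add, x, y => x + y
  | sub, x, y => x - y
  | mul, x, y => x * y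
  | div, x, y => x / y
  | lt, x, y => if x < y then 1 else 0
  | eq, x, y => if x = y then 1 else 0

/-- Expressions: constants, registers, array entries at a computed index, operations. -/
inductive Term
  | const (k : ℕ)
  | reg (i : ℕ)
  | arr (a : ℕ) (index : Term)
  | op (f : Op) (e₁ e₂ : Term)

/-- The value of an expression. -/
def Term.eval (s : Memory) : Term → ℕ
  | const k => k
  | reg i => s.reg i
  | arr a e => s.arr a (e.eval s)
  | op f e₁ e₂ => f.eval (e₁.eval s) (e₂.eval s)

/-- The number of steps that the evaluation of an expression takes. -/
def Term.cost : Term → ℕ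
  | const _ => 1
  | reg _ => 1
  | arr _ e => e.cost + 1
  | op _ e₁ e₂ => e₁.cost + e₂.cost + 1

/-- Programs. In `ite e` and `loop e`, the test succeeds when the value of `e` is nonzero. -/
inductive Program
  | skip
  | assign (i : ℕ) (e : Term)
  | store (a : ℕ) (index e : Term)
  | seq (c₁ c₂ : Program)
  | ite (e : Term) (c₁ c₂ : Program)
  | loop (e : Term) (c : Program)

/-- The memory after the assignment of `v` to register `i`. -/
def Memory.setReg (s : Memory) (i v : ℕ) : Memory :=
  { s with reg := Function.update s.reg i v }

/-- The memory after the assignment of `v` to entry `j` of array `a`. -/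
def Memory.setArr (s : Memory) (a j v : ℕ) : Memory :=
  { s with arr := Function.update s.arr a (Function.update (s.arr a) j v) }

/-- `Runs M c s t s'`: started in the memory `s`, the program `c` halts after exactly `t` steps with
memory `s'`, and every number that it writes to memory, and every index at which it writes, is less
than `M` (a write that would break this bound is not executed, and the program does not halt). -/
inductive Runs (M : ℕ) : Program → Memory → ℕ → Memory → Prop
  | skip (s : Memory) : Runs M .skip s 1 s
  | assign (i : ℕ) (e : Term) (s : Memory) (h : e.eval s < M) :
      Runs M (.assign i e) s (e.cost + 1) (s.setReg i (e.eval s))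
  | store (a : ℕ) (j e : Term) (s : Memory) (hj : j.eval s < M) (h : e.eval s < M) :
      Runs M (.store a j e) s (j.cost + e.cost + 1) (s.setArr a (j.eval s) (e.eval s))
  | seq {c₁ c₂ : Program} {s s' s'' : Memory} {t₁ t₂ : ℕ}
      (h₁ : Runs M c₁ s t₁ s') (h₂ : Runs M c₂ s' t₂ s'') :
      Runs M (.seq c₁ c₂) s (t₁ + t₂) s''
  | ite_true {e : Term} {c₁ c₂ : Program} {s s' : Memory} {t : ℕ}
      (he : e.eval s ≠ 0) (h : Runs M c₁ s t s') :
      Runs M (.ite e c₁ c₂) s (e.cost + 1 + t) s'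
  | ite_false {e : Term} {c₁ c₂ : Program} {s s' : Memory} {t : ℕ}
      (he : e.eval s = 0) (h : Runs M c₂ s t s') :
      Runs M (.ite e c₁ c₂) s (e.cost + 1 + t) s'
  | loop_true {e : Term} {c : Program} {s s' s'' : Memory} {t₁ t₂ : ℕ}
      (he : e.eval s ≠ 0) (h₁ : Runs M c s t₁ s') (h₂ : Runs M (.loop e c) s' t₂ s'') :
      Runs M (.loop e c) s (e.cost + 1 + t₁ + t₂) s''
  | loop_false {e : Term} {c : Program} {s : Memory} (he : e.eval s = 0) :
      Runs M (.loop e c) s (e.cost + 1) s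

/-- The memory at the start: register `0` holds the length of the input word `W`, array `0` holds the
codes of its letters, and everything else is `0`. -/
def input (W : List Letter) : Memory where
  reg i := if i = 0 then W.length else 0
  arr a j := if a = 0 then (W.map Letter.code).getD j 0 else 0

end QuarterTurn

/-!
Number the headings of the letters by `ZMod 4` and let `turn W i` be the turn before letter `i` of
the circular word `W`. Being a `90`-drome is a property of the turns: they are antisymmetric about
the centre, and the turn at the centre is a right turn. A boundary word does not backtrack
(`Polyomino.IsBoundaryWord.turn_ne_two`), so that no turn is a half turn, and only this property is
used of polyominoes, along with `4 ≤ n`.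

*Reduction to maximal `90`-dromes.* The turns of a circular word add up to zero modulo `4`. Those
inside a palindrome cancel, those inside a `90`-drome add up to a right turn, and so the turns at
the junctions of a factorization `A B C` with nonempty `B` and `C` add up to a half turn. If the
turns at the two ends of `B` were opposite, the remaining one would be a half turn, which is
impossible. Hence `B` cannot be extended about its centre, and likewise `C`
(`arms_eq_of_factorization`). It suffices to look at pairs of maximal `90`-dromes, of
half-lengths `arm W c`, the first of which ends where the second starts, and to test whether the
rest of the word is a palindrome (`hasQuarterTurnFactorization_iff`). Factorizations with one or no
nonempty `90`-drome are similar.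

*Counting.* Three centres of antisymmetry with nonzero turns cannot be close to each other compared
with their arms (`not_three_centers`): reflections about them generate translations, so that the
turns have periods, and by the theorem of Fine and Wilf (`gcd_period`) also the greatest common
divisor of those periods; therefore one of the central turns would be its own negative, hence zero.
So `O(n / r)` centres have an arm of at least `r`. Summation over dyadic scales shows that all arms
together have length `O(n log n)` (`sum_arm_le`), and that their logarithms add up to `O(n)`
(`sum_size_arm_le`). In a pair of adjacent maximal `90`-dromes, the longer one has only
logarithmically many possible partners, and so there are `O(n)` pairs (`sum_card_adjacent_le`).

*The program.* With `b` about `log n / log 4`, blocks of `b` letters are packed into numbers of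
size at most `n`, from each position forwards and, rotated, backwards. A comparison of two packed
blocks extends an arm by `b` letters at once, and the number of trailing zeros in base four of the
difference of two distinct blocks, read from a table, tells where they first differ. By the bound
on the sum of the arms all of them are found in time `O(n)` (`armProgram_spec`). Manacher's
algorithm finds the maximal palindromes of `W W` (`palProgram_spec`), after which a factor is tested
for being a palindrome in constant time. The centres are kept in linked lists according to where
their `90`-dromes end, which allows the `O(n)` adjacent pairs to be enumerated and tested
(`pairProgram_spec`). Each phase is a loop with a loop-free body, whose number of passes is bounded
by a decreasing measure (`Program.Reaches.loop`).
-/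

namespace QuarterTurn

/-! ### Loop-free programs and loops -/

@[simp] lemma Memory.reg_setReg (s : Memory) (i v j : ℕ) :
    (s.setReg i v).reg j = if j = i then v else s.reg j := by
  simp [Memory.setReg, Function.update_apply]

@[simp] lemma Memory.arr_setReg (s : Memory) (i v : ℕ) : (s.setReg i v).arr = s.arr := rfl

@[simp] lemma Memory.reg_setArr (s : Memory) (a j v : ℕ) : (s.setArr a j v).reg = s.reg := rfl

@[simp] lemma Memory.arr_setArr (s : Memory) (a j v a' x : ℕ) :
    (s.setArr a j v).arr a' x =
      if a' = a then (if x = j then v else s.arr a x) else s.arr a' x := by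
  simp only [Memory.setArr, Function.update_apply]
  split_ifs with h <;> simp_all

namespace Program

/-- The memory after a run of a loop-free program; loops are left out. -/
def exec : Program → Memory → Memory
  | skip, s => s
  | assign i e, s => s.setReg i (e.eval s)
  | store a j e, s => s.setArr a (j.eval s) (e.eval s)
  | seq c₁ c₂, s => c₂.exec (c₁.exec s)
  | ite e c₁ c₂, s => if e.eval s ≠ 0 then c₁.exec s else c₂.exec s
  | loop _ _, s => s

/-- The program executes no loop from the memory `s`, and all its writes obey the bound `M`. -/
def Safe (M : ℕ) : Program → Memory → Prop
  | skip, _ => True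
  | assign _ e, s => e.eval s < M
  | store _ j e, s => j.eval s < M ∧ e.eval s < M
  | seq c₁ c₂, s => c₁.Safe M s ∧ c₂.Safe M (c₁.exec s)
  | ite e c₁ c₂, s => if e.eval s ≠ 0 then c₁.Safe M s else c₂.Safe M s
  | loop _ _, _ => False

/-- An upper bound for the running time of a loop-free program. -/
def maxCost : Program → ℕ
  | skip => 1
  | assign _ e => e.cost + 1
  | store _ j e => j.cost + e.cost + 1
  | seq c₁ c₂ => c₁.maxCost + c₂.maxCost
  | ite e c₁ c₂ => e.cost + 1 + c₁.maxCost + c₂.maxCost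
  | loop _ _ => 0

/-- From `s` the program halts within `T` steps in a memory that satisfies `Q`. -/
def Reaches (M : ℕ) (c : Program) (s : Memory) (T : ℕ) (Q : Memory → Prop) : Prop :=
  ∃ t s', Runs M c s t s' ∧ t ≤ T ∧ Q s'

lemma runs_exec {M : ℕ} (c : Program) (s : Memory) (h : c.Safe M s) :
    ∃ t ≤ c.maxCost, Runs M c s t (c.exec s) := by
  induction c generalizing s with
  | skip => exact ⟨1, le_rfl, .skip s⟩
  | assign i e => exact ⟨_, le_rfl, .assign i e s h⟩
  | store a j e => exact ⟨_, le_rfl, .store a j e s h.1 h.2⟩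
  | seq c₁ c₂ ih₁ ih₂ =>
    obtain ⟨t₁, ht₁, h₁⟩ := ih₁ s h.1
    obtain ⟨t₂, ht₂, h₂⟩ := ih₂ _ h.2
    exact ⟨_, Nat.add_le_add ht₁ ht₂, .seq h₁ h₂⟩
  | ite e c₁ c₂ ih₁ ih₂ =>
    by_cases he : e.eval s = 0
    · simp only [Safe, he, ne_eq, not_true_eq_false, if_false] at h
      obtain ⟨t, ht, hr⟩ := ih₂ s h
      refine ⟨e.cost + 1 + t, ?_, ?_⟩
      swap
      · simpa only [exec, he, ne_eq, not_true_eq_false, if_false] using Runs.ite_false he hr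
      · simp only [maxCost]; omega
    · simp only [Safe, he, ne_eq, not_false_eq_true, if_true] at h
      obtain ⟨t, ht, hr⟩ := ih₁ s h
      refine ⟨e.cost + 1 + t, ?_, ?_⟩
      swap
      · simpa only [exec, he, ne_eq, not_false_eq_true, if_true] using Runs.ite_true he hr
      · simp only [maxCost]; omega
  | loop e c => exact h.elim

lemma Reaches.of_safe {M : ℕ} {c : Program} {s : Memory} {Q : Memory → Prop}
    (h : c.Safe M s) (hQ : Q (c.exec s)) : c.Reaches M s c.maxCost Q := by
  obtain ⟨t, ht, hr⟩ := runs_exec c s h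
  exact ⟨t, _, hr, ht, hQ⟩

lemma Reaches.seq {M : ℕ} {c₁ c₂ : Program} {s : Memory} {T₁ T₂ : ℕ} {P Q : Memory → Prop}
    (h₁ : c₁.Reaches M s T₁ P) (h₂ : ∀ s', P s' → c₂.Reaches M s' T₂ Q) :
    (Program.seq c₁ c₂).Reaches M s (T₁ + T₂) Q := by
  obtain ⟨t₁, s₁, hr₁, ht₁, hP⟩ := h₁
  obtain ⟨t₂, s₂, hr₂, ht₂, hQ⟩ := h₂ s₁ hP
  exact ⟨_, s₂, .seq hr₁ hr₂, Nat.add_le_add ht₁ ht₂, hQ⟩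

lemma Reaches.mono {M : ℕ} {c : Program} {s : Memory} {T T' : ℕ} {P Q : Memory → Prop}
    (h : c.Reaches M s T P) (hT : T ≤ T') (hPQ : ∀ s', P s' → Q s') : c.Reaches M s T' Q := by
  obtain ⟨t, s', hr, ht, hP⟩ := h
  exact ⟨t, s', hr, ht.trans hT, hPQ _ hP⟩

/-- A loop with a loop-free body that keeps the invariant `I` and decreases the measure `μ`
makes at most `μ s` passes. -/
lemma Reaches.loop {M : ℕ} {e : Term} {c : Program} (I : Memory → Prop) (μ : Memory → ℕ)
    (hstep : ∀ s, I s → e.eval s ≠ 0 → c.Safe M s ∧ I (c.exec s) ∧ μ (c.exec s) < μ s)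
    {s : Memory} (hs : I s) {m : ℕ} (hm : μ s ≤ m) :
    (Program.loop e c).Reaches M s ((m + 1) * (e.cost + 1 + c.maxCost))
      (fun s' => I s' ∧ e.eval s' = 0) := by
  induction m generalizing s with
  | zero =>
    by_cases he : e.eval s = 0
    · exact ⟨_, s, .loop_false he, by simp, hs, he⟩
    · exact absurd (hstep s hs he).2.2 (by omega)
  | succ m ih =>
    by_cases he : e.eval s = 0
    · exact ⟨_, s, .loop_false he, by nlinarith, hs, he⟩
    · obtain ⟨hsafe, hI, hμ⟩ := hstep s hs he
      obtain ⟨t₁, ht₁, hr₁⟩ := runs_exec c s hsafe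
      obtain ⟨t₂, s₂, hr₂, ht₂, hQ⟩ := ih hI (by omega)
      refine ⟨_, s₂, .loop_true he hr₁ hr₂, ?_, hQ⟩
      have : (m + 1 + 1) * (e.cost + 1 + c.maxCost)
        = (e.cost + 1 + c.maxCost) + (m + 1) * (e.cost + 1 + c.maxCost) := by ring
      omega

end Program

/-! ### Antisymmetric centres of a sequence -/

/-- Fine and Wilf's theorem: if `p` and `q` are periods of the sequence `f` on `[0, L)` and
`p + q ≤ L`, then so is their greatest common divisor. -/
theorem gcd_period {α : Type*} (f : ℕ → α) (N : ℕ) : ∀ p q L : ℕ, p + q ≤ N → 0 < p → 0 < q →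
    p + q ≤ L → (∀ x, x + p < L → f (x + p) = f x) → (∀ x, x + q < L → f (x + q) = f x) →
    ∀ x, x + p.gcd q < L → f (x + p.gcd q) = f x := by
  induction N with
  | zero => intro p q L h hp; omega
  | succ N ih =>
    -- the step for `p < q`, by subtraction: `q - p` is a period on `[0, L - p)`
    have key : ∀ p q L : ℕ, p + q ≤ N + 1 → 0 < p → p < q → p + q ≤ L →
        (∀ x, x + p < L → f (x + p) = f x) → (∀ x, x + q < L → f (x + q) = f x) →
        ∀ x, x + p.gcd q < L → f (x + p.gcd q) = f x := by
      intro p q L hN hp hpq hL h₁ h₂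
      have hg : p.gcd q = p.gcd (q - p) := by
        rw [Nat.gcd_comm p (q - p), Nat.gcd_sub_self_left hpq.le, Nat.gcd_comm]
      rw [hg]
      have hle : p.gcd (q - p) ≤ q - p := Nat.le_of_dvd (by omega) (Nat.gcd_dvd_right _ _)
      have hshort := ih p (q - p) (L - p) (by omega) hp (by omega) (by omega)
        (fun x hx => h₁ x (by omega)) (fun x hx => by
          rw [← h₁ (x + (q - p)) (by omega), show x + (q - p) + p = x + q by omega]
          exact h₂ x (by omega))
      intro x hx
      by_cases hx' : x + p.gcd (q - p) < L - p
      · exact hshort x hx'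
      · obtain ⟨y, rfl⟩ : ∃ y, x = y + p := ⟨x - p, by omega⟩
        rw [show y + p + p.gcd (q - p) = y + p.gcd (q - p) + p by omega, h₁ _ (by omega),
          h₁ _ (by omega)]
        exact hshort y (by omega)
    intro p q L hN hp hq hL h₁ h₂
    rcases lt_trichotomy p q with h | rfl | h
    · exact key p q L hN hp h hL h₁ h₂
    · simpa using h₁
    · rw [Nat.gcd_comm]
      exact key q p L (by omega) hq h (by omega) h₂ h₁

/-- The sequence `f` is antisymmetric about `c` up to distance `ℓ`; its value at `c` is free. -/
def AntiAt (f : ℤ → ZMod 4) (c : ℤ) (ℓ : ℕ) : Prop :=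
  ∀ x : ℤ, 0 < x → x ≤ ℓ → f (c + x) = -f (c - x)

lemma eq_zero_of_eq_neg {z : ZMod 4} (h : z = -z) (h2 : z ≠ 2) : z = 0 := by
  revert z; decide

/-- Three centres of antisymmetry with nonzero values cannot be close to each other compared with
the distances up to which they are antisymmetric: to the right of the first centre the sequence
would have the period `2 g`, for `g` the greatest common divisor of the gaps, and its values at the
multiples of `g` would contradict the antisymmetry about the third centre. -/
theorem not_three_centers {f : ℤ → ZMod 4} (h2 : ∀ i, f i ≠ 2) {c : ℤ} {a b ℓ : ℕ}
    (hb : 0 < b) (hba : b < a) (hℓ : 3 * a ≤ ℓ)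
    (h₀ : f c ≠ 0) (h₁ : f (c + b) ≠ 0)
    (hc₀ : AntiAt f c ℓ) (hc₁ : AntiAt f (c + b) ℓ) (hc₂ : AntiAt f (c + a) ℓ) : False := by
  set F : ℕ → ZMod 4 := fun x => f (c + x + 1) with hF
  have shift : ∀ d : ℕ, d ≤ a → AntiAt f (c + d) ℓ → ∀ x : ℕ, x + 1 + d ≤ ℓ →
      F (x + 2 * d) = F x := by
    intro d hd hcd x hx
    have e₁ := hcd (x + 1 + d) (by omega) (by omega)
    have e₂ := hc₀ (x + 1) (by omega) (by omega)
    simp only [hF]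
    rw [show c + ((x + 2 * d : ℕ) : ℤ) + 1 = c + d + (x + 1 + d) by push_cast; ring, e₁,
      show c + (d : ℤ) - (x + 1 + d) = c - (x + 1) by ring,
      show c + (x : ℤ) + 1 = c + (x + 1) by ring, e₂]
  set g := a.gcd b with hg
  have hgpos : 0 < g := Nat.gcd_pos_of_pos_right _ hb
  have hgb : g ≤ b := Nat.le_of_dvd hb (Nat.gcd_dvd_right _ _)
  have hper : ∀ x, x + 2 * g < ℓ + b → F (x + 2 * g) = F x := by
    have := gcd_period F (2 * a + 2 * b) (2 * a) (2 * b) (ℓ + b) le_rfl (by omega) (by omega)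
      (by omega) (fun x hx => shift a le_rfl hc₂ x (by omega))
      (fun x hx => shift b hba.le hc₁ x (by omega))
    rwa [Nat.gcd_mul_left] at this
  have hper' : ∀ k x, x + 2 * g * k < ℓ + b → F (x + 2 * g * k) = F x := by
    intro k
    induction k with
    | zero => intro x _; simp
    | succ k ih =>
      intro x hx
      rw [show x + 2 * g * (k + 1) = x + 2 * g * k + 2 * g by ring] at hx ⊢
      rw [hper _ hx, ih x (by omega)]
  -- values agree on positions that differ by a multiple of `2 g`
  have hagree : ∀ x y k : ℕ, x + 2 * g * k = y → y < ℓ + b → F y = F x := by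
    rintro x y k rfl hy
    exact hper' k x hy
  obtain ⟨a', ha'⟩ : g ∣ a := Nat.gcd_dvd_left _ _
  obtain ⟨b', hb'⟩ : g ∣ b := Nat.gcd_dvd_right _ _
  have hcop : Nat.Coprime a' b' := by
    have := Nat.gcd_mul_left g a' b'
    rw [← ha', ← hb', ← hg] at this
    exact Nat.eq_of_mul_eq_mul_left hgpos (by rw [mul_one]; exact this.symm)
  have hab' : b' < a' := by
    rw [ha', hb'] at hba
    exact lt_of_mul_lt_mul_left hba (Nat.zero_le g)
  have hb'pos : 0 < b' := by
    rcases Nat.eq_zero_or_pos b' with h | h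
    · rw [h] at hb'; omega
    · exact h
  -- `f` vanishes next to the third centre, at distance `g`
  have hzero : F (a - g - 1) = 0 := by
    have e₁ := hc₂ g (by omega) (by omega)
    have e₂ : F (a + g - 1) = F (a - g - 1) := hagree _ _ 1 (by omega) (by omega)
    have e₃ : F (a + g - 1) = f (c + a + g) := by
      simp only [hF]; congr 1; omega
    have e₄ : F (a - g - 1) = f (c + a - g) := by
      simp only [hF]; congr 1; omega
    rw [e₃, e₄] at e₂
    rw [e₂] at e₁
    rw [e₄]
    exact eq_zero_of_eq_neg e₁ (h2 _)
  have h2b : F (2 * b - 1) ≠ 0 := by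
    have e := hc₁ b (by omega) (by omega)
    have : F (2 * b - 1) = f (c + b + b) := by simp only [hF]; congr 1; omega
    rw [this, e]
    simpa using h₀
  have hb1 : F (b - 1) ≠ 0 := by
    have : F (b - 1) = f (c + b) := by simp only [hF]; congr 1; omega
    rwa [this]
  -- positions `g * u` and `g * v` with `u`, `v` of the same parity carry the same value
  have hpar : ∀ u v : ℕ, 0 < u → u ≤ v → u % 2 = v % 2 → g * v < ℓ + b →
      F (g * v - 1) = F (g * u - 1) := by
    intro u v hu huv hmod hv
    obtain ⟨k, rfl⟩ : ∃ k, v = u + 2 * k := ⟨(v - u) / 2, by omega⟩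
    refine hagree _ _ k ?_ (by omega)
    have : 0 < g * u := Nat.mul_pos hgpos hu
    rw [mul_add]
    have e : g * (2 * k) = 2 * g * k := by ring
    omega
  have hpar' : ∀ u v : ℕ, 0 < u → 0 < v → u % 2 = v % 2 → g * u < ℓ + b → g * v < ℓ + b →
      F (g * v - 1) = F (g * u - 1) := by
    intro u v hu hv hmod hgu hgv
    rcases le_total u v with h | h
    · exact hpar u v hu h hmod hgv
    · exact (hpar v u hv h hmod.symm hgu).symm
  have ea : a - g - 1 = g * (a' - 1) - 1 := by rw [Nat.mul_sub, mul_one, ← ha']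
  have eb : 2 * b - 1 = g * (2 * b') - 1 := by rw [hb']; congr 1; ring
  have hga : g * (a' - 1) < ℓ + b := by rw [Nat.mul_sub, mul_one, ← ha']; omega
  have hgb2 : g * (2 * b') < ℓ + b := by
    rw [show g * (2 * b') = 2 * b by rw [hb']; ring]; omega
  rcases Nat.even_or_odd a' with h | h
  · have hodd : b' % 2 = 1 := by
      by_contra hcon
      have : 2 ∣ a'.gcd b' := Nat.dvd_gcd h.two_dvd (by omega)
      rw [hcop] at this
      omega
    refine hb1 ?_
    rw [← hzero, ea]
    conv_lhs => rw [hb']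
    refine hpar' _ _ (by omega) hb'pos ?_ hga (by rw [← hb']; omega)
    have := Nat.even_iff.mp h
    omega
  · refine h2b ?_
    rw [← hzero, ea, eb]
    refine hpar' _ _ (by omega) (by omega) ?_ hga hgb2
    have := Nat.odd_iff.mp h
    omega

/-! ### Counting long centres -/

/-- `R` assigns to each point a distance strictly below which `f` is antisymmetric about the point,
and this distance is zero at the zeros of `f`. -/
def IsArmFunction (f : ℤ → ZMod 4) (R : ℕ → ℕ) : Prop :=
  ∀ c : ℕ, 1 ≤ R c → f c ≠ 0 ∧ AntiAt f c (R c - 1)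

section Counting

variable {f : ℤ → ZMod 4} {R : ℕ → ℕ}

lemma AntiAt.mono {c : ℤ} {k l : ℕ} (h : AntiAt f c l) (hkl : k ≤ l) : AntiAt f c k :=
  fun x hx hxk => h x hx (by omega)

/-- A window at most about a third as long as `r` has no three centres with arms of at least `r`. -/
lemma card_le_two_of_window (h2 : ∀ i, f i ≠ 2) (hR : IsArmFunction f R) {S : Finset ℕ}
    {y w r : ℕ} (hr : 1 ≤ r) (hw : 3 * (w - 1) ≤ r - 1)
    (hS : ∀ c ∈ S, y ≤ c ∧ c < y + w ∧ r ≤ R c) : S.card ≤ 2 := by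
  by_contra hcard
  have hne : S.Nonempty := Finset.card_pos.mp (by omega)
  obtain ⟨m, hm⟩ : ∃ m, m ∈ (S.erase (S.min' hne)).erase (S.max' hne) := by
    refine Finset.card_pos.mp ?_
    have h₁ := Finset.pred_card_le_card_erase (s := S) (a := S.min' hne)
    have h₂ := Finset.pred_card_le_card_erase (s := S.erase (S.min' hne)) (a := S.max' hne)
    omega
  simp only [Finset.mem_erase] at hm
  obtain ⟨hmax, hmin, hmS⟩ := hm
  have h₀ := hS _ (S.min'_mem hne)
  have h₁ := hS _ hmS
  have h₂ := hS _ (S.max'_mem hne)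
  have lt₁ : S.min' hne < m := lt_of_le_of_ne (S.min'_le _ hmS) (Ne.symm hmin)
  have lt₂ : m < S.max' hne := lt_of_le_of_ne (S.le_max' _ hmS) hmax
  set c := S.min' hne
  set d := S.max' hne
  have e₁ : ((c : ℤ) + (m - c : ℕ)) = m := by omega
  have e₂ : ((c : ℤ) + (d - c : ℕ)) = d := by omega
  have a₀ := hR c (by omega)
  have a₁ := hR m (by omega)
  have a₂ := hR d (by omega)
  refine not_three_centers h2 (c := c) (a := d - c) (b := m - c) (ℓ := r - 1) (by omega)
    (by omega) (by omega) a₀.1 ?_ (a₀.2.mono (by omega)) ?_ ?_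
  · rw [e₁]; exact a₁.1
  · rw [e₁]; exact a₁.2.mono (by omega)
  · rw [e₂]; exact a₂.2.mono (by omega)

lemma card_mul_le_of_interval (h2 : ∀ i, f i ≠ 2) (hR : IsArmFunction f R) {S : Finset ℕ}
    {y N r : ℕ} (hr : 1 ≤ r) (hS : ∀ c ∈ S, y ≤ c ∧ c < y + N ∧ r ≤ R c) :
    S.card * r ≤ 6 * N + 6 * r := by
  obtain ⟨w, hw⟩ : ∃ w, w = (r + 2) / 3 := ⟨_, rfl⟩
  have hwpos : 0 < w := by omega
  have hcard : S.card ≤ 2 * (Finset.range (N / w + 1)).card := by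
    refine Finset.card_le_mul_card_image_of_maps_to (f := fun c => (c - y) / w) ?_ 2 ?_
    · intro c hc
      have := hS c hc
      rw [Finset.mem_range, Nat.lt_succ_iff]
      exact Nat.div_le_div_right (by omega)
    · intro k _
      refine card_le_two_of_window h2 hR (y := y + k * w) (w := w) hr (by omega) ?_
      intro c hc
      rw [Finset.mem_filter] at hc
      have h := hS c hc.1
      have hk := hc.2
      have h₁ := Nat.div_mul_le_self (c - y) w
      have h₂ := Nat.lt_div_mul_add hwpos (a := c - y)
      rw [hk] at h₁ h₂
      omega
  rw [Finset.card_range] at hcard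
  have h₁ := Nat.div_mul_le_self N w
  calc S.card * r ≤ 2 * (N / w + 1) * (3 * w) := Nat.mul_le_mul hcard (by omega)
    _ = 6 * (N / w * w) + 6 * w := by ring
    _ ≤ 6 * N + 6 * r := by omega

variable {n : ℕ}

lemma card_arm_ge_mul_le (h2 : ∀ i, f i ≠ 2) (hR : IsArmFunction f R) (hn : ∀ c, 2 * R c ≤ n)
    {r : ℕ} (hr : 1 ≤ r) :
    ((Finset.Ico n (2 * n)).filter (fun c => r ≤ R c)).card * r ≤ 12 * n := by
  have h := card_mul_le_of_interval h2 hR (y := n) (N := n) hr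
    (S := (Finset.Ico n (2 * n)).filter (fun c => r ≤ R c)) (fun c hc => by
      rw [Finset.mem_filter, Finset.mem_Ico] at hc
      omega)
  rcases Finset.eq_empty_or_nonempty
    ((Finset.Ico n (2 * n)).filter (fun c => r ≤ R c)) with h₀ | ⟨c, hc⟩
  · simp [h₀]
  · rw [Finset.mem_filter] at hc
    have := hn c
    omega

lemma le_sum_two_pow {x L : ℕ} (h : x < 2 ^ L) :
    x ≤ ∑ a ∈ Finset.range L, if 2 ^ a ≤ x then 2 ^ a else 0 := by
  induction L with
  | zero => simp at h; omega
  | succ L ih =>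
    rw [Finset.sum_range_succ]
    by_cases hx : x < 2 ^ L
    · exact (ih hx).trans (Nat.le_add_right _ _)
    · push Not at hx
      rw [if_pos hx]
      have : ∑ a ∈ Finset.range L, (if 2 ^ a ≤ x then 2 ^ a else 0) = ∑ a ∈ Finset.range L, 2 ^ a :=
        Finset.sum_congr rfl fun a ha => if_pos
          ((Nat.pow_le_pow_right (by norm_num) (Finset.mem_range.mp ha).le).trans hx)
      rw [this]
      have hg := Nat.geomSum_eq (m := 2) le_rfl L
      have h1 : 1 ≤ 2 ^ L := Nat.one_le_two_pow
      rw [pow_succ] at h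
      omega

/-- Each dyadic scale contributes at most `12 n` to the sum of all arms. -/
theorem sum_arm_le (h2 : ∀ i, f i ≠ 2) (hR : IsArmFunction f R) (hn : ∀ c, 2 * R c ≤ n) {L : ℕ}
    (hL : n < 2 ^ L) : ∑ c ∈ Finset.Ico n (2 * n), R c ≤ 12 * n * L := by
  calc ∑ c ∈ Finset.Ico n (2 * n), R c
      ≤ ∑ c ∈ Finset.Ico n (2 * n), ∑ a ∈ Finset.range L, if 2 ^ a ≤ R c then 2 ^ a else 0 :=
        Finset.sum_le_sum fun c _ => le_sum_two_pow (by have := hn c; omega)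
    _ = ∑ a ∈ Finset.range L, ∑ c ∈ Finset.Ico n (2 * n), if 2 ^ a ≤ R c then 2 ^ a else 0 :=
        Finset.sum_comm
    _ ≤ ∑ a ∈ Finset.range L, 12 * n := Finset.sum_le_sum fun a _ => by
        rw [← Finset.sum_filter, Finset.sum_const, smul_eq_mul]
        exact card_arm_ge_mul_le h2 hR hn Nat.one_le_two_pow
    _ = 12 * n * L := by simp [mul_comm]

/-- The sum of the binary logarithms of all arms is linear in `n`. -/
theorem sum_size_arm_le (h2 : ∀ i, f i ≠ 2) (hR : IsArmFunction f R) (hn : ∀ c, 2 * R c ≤ n) :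
    ∑ c ∈ Finset.Ico n (2 * n), (R c).size ≤ 24 * n := by
  have hsize : ∀ c, (R c).size = ∑ a ∈ Finset.range n.size, if 2 ^ a ≤ R c then 1 else 0 := by
    intro c
    rw [← Finset.sum_filter, Finset.sum_const, smul_eq_mul, mul_one]
    have : (Finset.range n.size).filter (fun a => 2 ^ a ≤ R c) = Finset.range (R c).size := by
      ext a
      have hle : (R c).size ≤ n.size := Nat.size_le_size (by have := hn c; omega)
      rw [Finset.mem_filter, Finset.mem_range, Finset.mem_range, ← Nat.lt_size]
      omega
    rw [this, Finset.card_range]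
  calc ∑ c ∈ Finset.Ico n (2 * n), (R c).size
      = ∑ c ∈ Finset.Ico n (2 * n), ∑ a ∈ Finset.range n.size, if 2 ^ a ≤ R c then 1 else 0 :=
        Finset.sum_congr rfl fun c _ => hsize c
    _ = ∑ a ∈ Finset.range n.size, ∑ c ∈ Finset.Ico n (2 * n), if 2 ^ a ≤ R c then 1 else 0 :=
        Finset.sum_comm
    _ ≤ ∑ a ∈ Finset.range n.size, 12 * n / 2 ^ a := Finset.sum_le_sum fun a _ => by
        rw [← Finset.sum_filter, Finset.sum_const, smul_eq_mul, mul_one,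
          Nat.le_div_iff_mul_le (by positivity)]
        exact card_arm_ge_mul_le h2 hR hn Nat.one_le_two_pow
    _ ≤ 12 * n * 2 / (2 - 1) := Nat.geom_sum_le le_rfl _ _
    _ = 24 * n := by omega

/-- At most `12` centres have an arm of a given dyadic size and lie at the distance of their arm
from the point `J`. -/
lemma card_dyadic_le (h2 : ∀ i, f i ≠ 2) (hR : IsArmFunction f R) {S : Finset ℕ} {J k : ℕ}
    (hS : (∀ x ∈ S, x + R x = J ∧ (R x).size = k) ∨ (∀ x ∈ S, x = J + R x ∧ (R x).size = k)) :
    S.card ≤ 12 := by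
  rcases Nat.eq_zero_or_pos k with rfl | hk
  · refine (Finset.card_le_card (t := {J}) fun x hx => ?_).trans (by simp)
    rw [Finset.mem_singleton]
    rcases hS with hS | hS
    · have := hS x hx
      rw [Nat.size_eq_zero] at this
      omega
    · have := hS x hx
      rw [Nat.size_eq_zero] at this
      omega
  · obtain ⟨a, rfl⟩ : ∃ a, k = a + 1 := ⟨k - 1, by omega⟩
    have hpos : 1 ≤ 2 ^ a := Nat.one_le_two_pow
    have hrange : ∀ x, (R x).size = a + 1 → 2 ^ a ≤ R x ∧ R x < 2 * 2 ^ a := by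
      intro x hx
      refine ⟨Nat.lt_size.mp (by omega), ?_⟩
      have := Nat.lt_size_self (R x)
      rwa [hx, pow_succ, mul_comm] at this
    have hfin : ∀ y, (∀ c ∈ S, y ≤ c ∧ c < y + 2 ^ a ∧ 2 ^ a ≤ R c) → S.card ≤ 12 := by
      intro y hy
      have h := card_mul_le_of_interval h2 hR hpos hy
      exact Nat.le_of_mul_le_mul_right (by omega) hpos
    rcases hS with hS | hS
    · refine hfin (J + 1 - 2 * 2 ^ a) fun c hc => ?_
      have h₁ := hS c hc
      have h₂ := hrange c h₁.2
      omega
    · refine hfin (J + 2 ^ a) fun c hc => ?_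
      have h₁ := hS c hc
      have h₂ := hrange c h₁.2
      omega

/-- Only logarithmically many centres with an arm of at most `m` have that arm end at one of two
given points, because each dyadic size allows a bounded number. -/
lemma card_small_le (h2 : ∀ i, f i ≠ 2) (hR : IsArmFunction f R) {S : Finset ℕ} {J₁ J₂ m : ℕ}
    (hS : (∀ x ∈ S, (x + R x = J₁ ∨ x + R x = J₂) ∧ R x ≤ m) ∨
      (∀ x ∈ S, (x = J₁ + R x ∨ x = J₂ + R x) ∧ R x ≤ m)) :
    S.card ≤ 24 * (m.size + 1) := by
  have : S.card ≤ 24 * (Finset.range (m.size + 1)).card := by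
    refine Finset.card_le_mul_card_image_of_maps_to (f := fun x => (R x).size) ?_ 24 ?_
    · intro x hx
      rw [Finset.mem_range, Nat.lt_succ_iff]
      refine Nat.size_le_size ?_
      rcases hS with hS | hS
      · exact (hS x hx).2
      · exact (hS x hx).2
    · intro k _
      rcases hS with hS | hS
      · rw [← Finset.card_filter_add_card_filter_not (fun x => x + R x = J₁)]
        refine Nat.add_le_add (card_dyadic_le h2 hR (J := J₁) (k := k) (.inl ?_))
          (card_dyadic_le h2 hR (J := J₂) (k := k) (.inl ?_)) <;>
        · intro x hx
          simp only [Finset.mem_filter] at hx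
          have := hS x hx.1.1
          omega
      · rw [← Finset.card_filter_add_card_filter_not (fun x => x = J₁ + R x)]
        refine Nat.add_le_add (card_dyadic_le h2 hR (J := J₁) (k := k) (.inr ?_))
          (card_dyadic_le h2 hR (J := J₂) (k := k) (.inr ?_)) <;>
        · intro x hx
          simp only [Finset.mem_filter] at hx
          have := hS x hx.1.1
          omega
  rwa [Finset.card_range] at this

/-- The number of pairs of adjacent maximal arms on a circle of length `n` is linear in `n`: the
longer arm of a pair has at most logarithmically many partners, and long arms are rare. -/
theorem sum_card_adjacent_le (h2 : ∀ i, f i ≠ 2) (hR : IsArmFunction f R)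
    (hn : ∀ c, 2 * R c ≤ n) :
    ∑ c ∈ Finset.Ico n (2 * n),
      ((Finset.Ico n (2 * n)).filter (fun x => (x + R x) % n = (c - R c) % n)).card
      ≤ 1200 * n := by
  rcases Nat.eq_zero_or_pos n with rfl | hpos
  · simp
  set I := Finset.Ico n (2 * n) with hI
  have hmod : ∀ y j : ℕ, y < 3 * n → y % n = j → y = j ∨ y = j + n ∨ y = j + 2 * n := by
    intro y j hy hj
    have h₁ := Nat.div_add_mod y n
    have h₂ : y / n < 3 := Nat.div_lt_of_lt_mul (by omega)
    interval_cases h : y / n <;> omega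
  have hfst : ∀ c ∈ I,
      (I.filter (fun x => (x + R x) % n = (c - R c) % n ∧ R x ≤ R c)).card
        ≤ 24 * ((R c).size + 1) := by
    intro c _
    have hj := Nat.mod_lt (c - R c) hpos
    refine card_small_le h2 hR (J₁ := (c - R c) % n + n) (J₂ := (c - R c) % n + 2 * n) (.inl ?_)
    intro x hx
    rw [Finset.mem_filter, hI, Finset.mem_Ico] at hx
    have := hn x
    have := hmod (x + R x) _ (by omega) hx.2.1
    omega
  have hsnd : ∀ x ∈ I,
      (I.filter (fun c => (x + R x) % n = (c - R c) % n ∧ R c ≤ R x)).card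
        ≤ 24 * ((R x).size + 1) := by
    intro x _
    refine card_small_le h2 hR (J₁ := (x + R x) % n) (J₂ := (x + R x) % n + n) (.inr ?_)
    intro c hc
    rw [Finset.mem_filter, hI, Finset.mem_Ico] at hc
    have := hn c
    have := hmod (c - R c) _ (by omega) hc.2.1.symm
    omega
  have hsum : ∑ c ∈ I, 24 * ((R c).size + 1) ≤ 600 * n := by
    rw [← Finset.mul_sum, Finset.sum_add_distrib]
    have h₁ : ∑ c ∈ I, (R c).size ≤ 24 * n := sum_size_arm_le h2 hR hn
    have h₂ : ∑ c ∈ I, 1 = n := by simp [hI]; omega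
    rw [h₂]
    omega
  calc ∑ c ∈ I, (I.filter (fun x => (x + R x) % n = (c - R c) % n)).card
      ≤ ∑ c ∈ I, ((I.filter (fun x => (x + R x) % n = (c - R c) % n ∧ R x ≤ R c)).card
          + (I.filter (fun x => (x + R x) % n = (c - R c) % n ∧ R c ≤ R x)).card) := by
        refine Finset.sum_le_sum fun c _ =>
          (Finset.card_le_card ?_).trans (Finset.card_union_le _ _)
        intro x hx
        simp only [Finset.mem_union, Finset.mem_filter] at hx ⊢
        rcases le_total (R x) (R c) with h | h
        · exact .inl ⟨hx.1, hx.2, h⟩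
        · exact .inr ⟨hx.1, hx.2, h⟩
    _ = ∑ c ∈ I, (I.filter (fun x => (x + R x) % n = (c - R c) % n ∧ R x ≤ R c)).card
          + ∑ x ∈ I, (I.filter (fun c => (x + R x) % n = (c - R c) % n ∧ R c ≤ R x)).card := by
        rw [Finset.sum_add_distrib]
        congr 1
        simp only [Finset.card_filter]
        exact Finset.sum_comm
    _ ≤ 600 * n + 600 * n :=
        Nat.add_le_add ((Finset.sum_le_sum hfst).trans hsum) ((Finset.sum_le_sum hsnd).trans hsum)
    _ = 1200 * n := by ring

end Counting

/-! ### Cyclic words and their turns -/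

/-- The direction of a letter as a multiple of a counterclockwise quarter turn. -/
def heading (x : Letter) : ZMod 4 := (x.code : ZMod 4)

lemma heading_rot_three (x : Letter) : heading (x.rot 3) = heading x - 1 := by
  cases x <;> decide

/-- The letters of the circular word represented by `W`, indexed periodically by the integers. -/
def cyc (W : List Letter) (i : ℤ) : Letter := W.getD (i % (W.length : ℤ)).toNat Letter.u

/-- The turn between the letters `i - 1` and `i` of a circular word. -/
def turn (W : List Letter) (i : ℤ) : ZMod 4 := heading (cyc W i) - heading (cyc W (i - 1))

/-- The `2 r` letters around the point before letter `c` form a `90`-drome. -/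
def Matches (W : List Letter) (c : ℤ) (r : ℕ) : Prop :=
  ∀ j : ℕ, j < r → cyc W (c + j) = (cyc W (c - 1 - j)).rot 3

open Classical in
/-- Half the length of the longest `90`-drome with a given centre whose length is at most that of
the circular word. -/
noncomputable def arm (W : List Letter) (c : ℤ) : ℕ :=
  Nat.findGreatest (fun r => Matches W c r) (W.length / 2)

/-- The `len` letters from letter `k` on form a palindrome. -/
def PalOn (W : List Letter) (k : ℤ) (len : ℕ) : Prop :=
  ∀ j : ℕ, j < len → cyc W (k + j) = cyc W (k + len - 1 - j)

/-- The factor of length `len` from letter `i` on. -/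
def win (W : List Letter) (i : ℤ) (len : ℕ) : List Letter :=
  (List.range len).map fun j : ℕ => cyc W (i + j)

section Cyclic

variable {W : List Letter}

lemma Matches.mono {c : ℤ} {r r' : ℕ} (h : Matches W c r) (hr : r' ≤ r) : Matches W c r' :=
  fun j hj => h j (by omega)

lemma matches_arm (W : List Letter) (c : ℤ) : Matches W c (arm W c) := by
  classical
  exact Nat.findGreatest_spec (P := fun r => Matches W c r) (Nat.zero_le _)
    (fun j hj => absurd hj (Nat.not_lt_zero j))

lemma two_mul_arm_le (W : List Letter) (c : ℤ) : 2 * arm W c ≤ W.length := by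
  classical
  have : arm W c ≤ W.length / 2 := Nat.findGreatest_le _
  omega

lemma le_arm {c : ℤ} {r : ℕ} (h : Matches W c r) (hr : 2 * r ≤ W.length) : r ≤ arm W c := by
  classical
  exact Nat.le_findGreatest (by omega) h

lemma Matches.heading_eq {c : ℤ} {r : ℕ} (h : Matches W c r) {x : ℤ} (h₀ : 0 ≤ x) (hx : x < r) :
    heading (cyc W (c + x)) = heading (cyc W (c - 1 - x)) - 1 := by
  lift x to ℕ using h₀
  rw [h x (by exact_mod_cast hx), heading_rot_three]

lemma Matches.antiAt {c : ℤ} {r : ℕ} (h : Matches W c r) : AntiAt (turn W) c (r - 1) := by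
  intro x hx hxr
  have h₁ := h.heading_eq (x := x) hx.le (by omega)
  have h₂ := h.heading_eq (x := x - 1) (by omega) (by omega)
  simp only [turn]
  rw [h₁, show c + x - 1 = c + (x - 1) by ring, h₂, show c - 1 - (x - 1) = c - x by ring,
    show c - x - 1 = c - 1 - x by ring]
  ring

lemma Matches.turn_eq {c : ℤ} {r : ℕ} (h : Matches W c r) (hr : 1 ≤ r) : turn W c = -1 := by
  have h₁ := h.heading_eq (x := 0) le_rfl (by omega)
  simp only [turn]
  rw [add_zero, sub_zero] at h₁
  rw [h₁]
  ring

lemma isArmFunction_arm (W : List Letter) : IsArmFunction (turn W) (fun c => arm W c) := by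
  intro c hc
  have h := matches_arm W c
  refine ⟨?_, h.antiAt⟩
  rw [h.turn_eq hc]
  decide

/-- A `90`-drome that cannot be extended, because the turns at its ends are not opposite, has the
maximal length for its centre. -/
lemma arm_eq_of_turn_ne {c : ℤ} {r : ℕ} (h : Matches W c r) (hr : 1 ≤ r) (hn : 2 * r ≤ W.length)
    (hne : turn W (c + r) ≠ -turn W (c - r)) : arm W c = r := by
  refine le_antisymm ?_ (le_arm h hn)
  by_contra hlt
  have h' : Matches W c (r + 1) := (matches_arm W c).mono (by omega)
  exact hne (h'.antiAt r (by omega) (by omega))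

@[simp] lemma cyc_add_mul (i q : ℤ) : cyc W (i + W.length * q) = cyc W i := by
  simp [cyc]

lemma matches_add_mul (c q : ℤ) (r : ℕ) : Matches W (c + W.length * q) r ↔ Matches W c r := by
  refine forall_congr' fun j => forall_congr' fun _ => ?_
  rw [show c + W.length * q + j = c + j + W.length * q by ring,
    show c + W.length * q - 1 - j = c - 1 - j + W.length * q by ring, cyc_add_mul, cyc_add_mul]

lemma arm_add_mul (c q : ℤ) : arm W (c + W.length * q) = arm W c := by
  exact le_antisymm
    (le_arm ((matches_add_mul c q _).mp (matches_arm W _)) (two_mul_arm_le W _))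
    (le_arm ((matches_add_mul c q _).mpr (matches_arm W _)) (two_mul_arm_le W _))

lemma palOn_add_mul (c q : ℤ) (r : ℕ) : PalOn W (c + W.length * q) r ↔ PalOn W c r := by
  refine forall_congr' fun j => forall_congr' fun _ => ?_
  rw [show c + W.length * q + j = c + j + W.length * q by ring,
    show c + W.length * q + r - 1 - j = c + r - 1 - j + W.length * q by ring,
    cyc_add_mul, cyc_add_mul]

lemma turn_add_length (i : ℤ) : turn W (i + W.length) = turn W i := by
  have h₁ := cyc_add_mul (W := W) i 1
  have h₂ := cyc_add_mul (W := W) (i - 1) 1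
  rw [mul_one] at h₁ h₂
  simp only [turn]
  rw [h₁, show i + W.length - 1 = i - 1 + W.length by ring, h₂]

lemma win_add_mul (c q : ℤ) (r : ℕ) : win W (c + W.length * q) r = win W c r := by
  refine List.map_congr_left fun j _ => ?_
  rw [show c + W.length * q + j = c + j + W.length * q by ring, cyc_add_mul]

@[simp] lemma length_win (i : ℤ) (l : ℕ) : (win W i l).length = l := by simp [win]

@[simp] lemma getElem_win (i : ℤ) (l j : ℕ) (h : j < (win W i l).length) :
    (win W i l)[j] = cyc W (i + j) := by simp [win]

lemma win_add (i : ℤ) (a b : ℕ) : win W i (a + b) = win W i a ++ win W (i + a) b := by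
  simp only [win, List.range_add, List.map_append, List.map_map]
  congr 1
  refine List.map_congr_left fun j _ => ?_
  simp [add_assoc]

lemma rotate_eq_win (k : ℕ) : W.rotate k = win W k W.length := by
  refine List.ext_getElem (by simp) fun j h₁ h₂ => ?_
  rw [List.getElem_rotate, getElem_win, cyc]
  rw [List.length_rotate] at h₁
  have : (((k : ℤ) + j) % (W.length : ℤ)).toNat = (j + k) % W.length := by
    rw [add_comm]; exact_mod_cast rfl
  rw [this, List.getD_eq_getElem]

lemma isRotated_win (hW : 0 < W.length) (i : ℤ) : W ~r win W i W.length := by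
  refine ⟨(i % (W.length : ℤ)).toNat, ?_⟩
  have h : ((i % (W.length : ℤ)).toNat : ℤ) = i + W.length * -(i / W.length) := by
    rw [Int.toNat_of_nonneg (Int.emod_nonneg _ (by omega)), Int.emod_def]
    ring
  rw [rotate_eq_win, h, win_add_mul]

lemma palindrome_win_iff (i : ℤ) (l : ℕ) : (win W i l).Palindrome ↔ PalOn W i l := by
  have key : ∀ j : ℕ, j < l → i + ((l - 1 - j : ℕ) : ℤ) = i + l - 1 - j := by
    intro j hj; omega
  rw [List.Palindrome.iff_reverse_eq]
  constructor
  · intro h j hj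
    have h₁ : (win W i l).reverse[j]'(by simpa using hj) = (win W i l)[j]'(by simpa using hj) := by
      simp only [h]
    rw [List.getElem_reverse, getElem_win, getElem_win, length_win, key j hj] at h₁
    exact h₁.symm
  · intro h
    refine List.ext_getElem (by simp) fun j h₁ h₂ => ?_
    rw [length_win] at h₂
    rw [List.getElem_reverse, getElem_win, getElem_win, length_win, key j h₂]
    exact (h j h₂).symm

lemma isDrome_win {c : ℤ} {r : ℕ} (h : Matches W c r) : IsDrome 1 (win W (c - r) (2 * r)) := by
  refine ⟨win W (c - r) r, ?_⟩
  rw [two_mul, win_add]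
  congr 1
  refine List.ext_getElem (by simp) fun j h₁ h₂ => ?_
  rw [length_win] at h₁
  rw [List.getElem_map, List.getElem_reverse, getElem_win, getElem_win, length_win,
    sub_add_cancel, h j h₁]
  congr 2
  omega

lemma IsDrome.exists_matches {i : ℤ} {l : ℕ} (h : IsDrome 1 (win W i l)) :
    ∃ r : ℕ, l = 2 * r ∧ Matches W (i + r) r := by
  obtain ⟨Y, hY⟩ := h
  have hl : l = 2 * Y.length := by
    have := congrArg List.length hY
    simp at this
    omega
  refine ⟨Y.length, hl, fun j hj => ?_⟩
  have h₁ : (win W i l)[Y.length + j]'(by simp; omega)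
      = (Y ++ Y.reverse.map (Letter.rot (1 + 2)))[Y.length + j]'(by simp; omega) := by
    simp only [hY]
  have h₂ : (win W i l)[Y.length - 1 - j]'(by simp; omega)
      = (Y ++ Y.reverse.map (Letter.rot (1 + 2)))[Y.length - 1 - j]'(by simp; omega) := by
    simp only [hY]
  rw [getElem_win, List.getElem_append_right (by omega)] at h₁
  rw [getElem_win, List.getElem_append_left (by omega)] at h₂
  simp only [List.getElem_map, List.getElem_reverse, add_tsub_cancel_left] at h₁
  rw [← h₂] at h₁
  rw [show i + Y.length + (j : ℤ) = i + (Y.length + j : ℕ) by push_cast; ring, h₁]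
  congr 2
  omega

/-- Every point of a circular word has a representative in `[n, 2 n)`. -/
lemma exists_representative (hW : 0 < W.length) (d : ℤ) :
    ∃ c : ℕ, c ∈ Finset.Ico W.length (2 * W.length) ∧ ∃ q : ℤ, (c : ℤ) = d + W.length * q := by
  have h₁ := Int.emod_nonneg d (b := (W.length : ℤ)) (by omega)
  have h₂ := Int.emod_lt_of_pos d (b := (W.length : ℤ)) (by omega)
  refine ⟨W.length + (d % W.length).toNat, ?_, 1 - d / W.length, ?_⟩
  · rw [Finset.mem_Ico]; omega
  · push_cast
    rw [Int.toNat_of_nonneg h₁, Int.emod_def]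
    ring

lemma heading_eq_of_palOn {k : ℤ} {len : ℕ} (h : PalOn W k len) (hl : 0 < len) :
    heading (cyc W (k + len - 1)) = heading (cyc W k) := by
  have := h 0 hl
  simp only [Nat.cast_zero, add_zero, sub_zero] at this
  rw [this]

lemma Matches.heading_ends {p : ℤ} {r : ℕ} (h : Matches W (p + r) r) (hr : 1 ≤ r) :
    heading (cyc W (p + 2 * r - 1)) = heading (cyc W p) - 1 := by
  have := h.heading_eq (x := r - 1) (by omega) (by omega)
  rw [show p + r + (r - 1 : ℤ) = p + 2 * r - 1 by ring,
    show p + r - 1 - (r - 1 : ℤ) = p by ring] at this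
  exact this

/-- In a factorization into a palindrome and two nonempty `90`-dromes, the turns at the three
junctions (two of them if the palindrome is empty) add up to a half turn, because the total turn
vanishes modulo `4`. As no turn is a half turn, the turns at the ends of a `90`-drome are not
opposite, and both `90`-dromes are maximal. -/
lemma arms_eq_of_factorization (h2 : ∀ i, turn W i ≠ 2) {p : ℤ} {l s r : ℕ}
    (hA : PalOn W (p - l) l) (hs : 1 ≤ s) (hr : 1 ≤ r) (hB : Matches W (p + s) s)
    (hC : Matches W (p + 2 * s + r) r) (hn : l + 2 * s + 2 * r = W.length) :
    arm W (p + s) = s ∧ arm W (p + 2 * s + r) = r := by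
  set q : ℤ := p + 2 * s with hq
  set e : ℤ := q + 2 * r with he
  have hb := hB.heading_ends hs
  have hc := hC.heading_ends hr
  have hturn : (turn W p + turn W q + turn W e = 2) ∨ (turn W e = turn W p ∧
      turn W p + turn W q = 2) := by
    have hcyc : cyc W e = cyc W (p - l) := by
      have := cyc_add_mul (W := W) (p - l) 1
      rw [← this]
      congr 1
      rw [mul_one, ← hn, he, hq]
      push_cast
      ring
    rcases Nat.eq_zero_or_pos l with rfl | hl
    · right
      have hep : turn W e = turn W p := by
        rw [← turn_add_length p]
        congr 1
        rw [← hn, he, hq]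
        push_cast
        ring
      refine ⟨hep, ?_⟩
      rw [← hep]
      simp only [turn]
      rw [← hq] at hb
      rw [← he] at hc
      simp only [Nat.cast_zero, sub_zero] at hcyc
      rw [hb, hc, hcyc]
      ring
    · left
      have ha := heading_eq_of_palOn hA hl
      rw [sub_add_cancel, ← hcyc] at ha
      simp only [turn]
      rw [← hq] at hb
      rw [← he] at hc
      rw [hb, hc, ha]
      ring
  have hp2 := h2 p
  have he2 := h2 e
  refine ⟨arm_eq_of_turn_ne hB hs (by omega) ?_, arm_eq_of_turn_ne hC hr (by omega) ?_⟩
  · rw [show p + s + (s : ℤ) = q by rw [hq]; ring, show p + s - (s : ℤ) = p by ring]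
    generalize turn W p = x at *
    generalize turn W q = y at *
    generalize turn W e = z at *
    revert x y z
    decide
  · rw [show q + r + (r : ℤ) = e by rw [he]; ring, show q + r - (r : ℤ) = q by ring]
    generalize turn W p = x at *
    generalize turn W q = y at *
    generalize turn W e = z at *
    revert x y z
    decide

/-- The case of one nonempty `90`-drome; the turns at its two ends add up to a quarter turn. -/
lemma arm_eq_of_factorization {p : ℤ} {l r : ℕ} (hA : PalOn W (p - l) l) (hr : 1 ≤ r)
    (hC : Matches W (p + r) r) (hn : l + 2 * r = W.length) : arm W (p + r) = r := by
  set e : ℤ := p + 2 * r with he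
  have hc := hC.heading_ends hr
  have hcyc : cyc W e = cyc W (p - l) := by
    have := cyc_add_mul (W := W) (p - l) 1
    rw [← this]
    congr 1
    rw [mul_one, ← hn, he]
    push_cast
    ring
  refine arm_eq_of_turn_ne hC hr (by omega) ?_
  rw [show p + r + (r : ℤ) = e by rw [he]; ring, show p + r - (r : ℤ) = p by ring]
  rcases Nat.eq_zero_or_pos l with rfl | hl
  · have hep : turn W e = turn W p := by
      rw [← turn_add_length p]
      congr 1
      rw [← hn, he]
      push_cast
      ring
    have : turn W e = 1 := by
      simp only [turn]
      rw [← he] at hc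
      simp only [Nat.cast_zero, sub_zero] at hcyc
      rw [hc, hcyc]
      ring
    rw [← hep, this]
    decide
  · have ha := heading_eq_of_palOn hA hl
    rw [sub_add_cancel, ← hcyc] at ha
    have : turn W p + turn W e = 1 := by
      simp only [turn]
      rw [← he] at hc
      rw [hc, ha]
      ring
    intro hcon
    rw [hcon, add_neg_cancel] at this
    revert this
    decide

lemma exists_factors (h : HasQuarterTurnFactorization W) : ∃ (p : ℤ) (l s r : ℕ),
    PalOn W (p - l) l ∧ Matches W (p + s) s ∧ Matches W (p + 2 * s + r) r ∧
      l + 2 * s + 2 * r = W.length := by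
  obtain ⟨A, B, C, ⟨k, hk⟩, hA, hB, hC⟩ := h
  rw [rotate_eq_win] at hk
  have hlen : A.length + B.length + C.length = W.length := by
    have := congrArg List.length hk
    simp only [length_win, List.length_append] at this
    omega
  obtain ⟨la, hla⟩ : ∃ la, A.length = la := ⟨_, rfl⟩
  obtain ⟨lb, hlb⟩ : ∃ lb, B.length = lb := ⟨_, rfl⟩
  obtain ⟨lc, hlc⟩ : ∃ lc, C.length = lc := ⟨_, rfl⟩
  rw [hla, hlb, hlc] at hlen
  rw [← hlen, win_add, win_add] at hk
  obtain ⟨hk₁, rfl⟩ := List.append_inj hk (by simp [hla, hlb])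
  obtain ⟨rfl, rfl⟩ := List.append_inj hk₁ (by simp [hla])
  obtain ⟨s, rfl, hs⟩ := hB.exists_matches
  obtain ⟨r, rfl, hr⟩ := hC.exists_matches
  rw [palindrome_win_iff] at hA
  refine ⟨k + la, la, s, r, by simpa using hA, hs, ?_, hlen⟩
  push_cast at hr
  rwa [show (k : ℤ) + la + 2 * s = k + (la + 2 * s) by ring]

/-- The test to which the theorem is reduced: a circular word has a quarter-turn factorization if
and only if it has one whose nonempty `90`-dromes are maximal. The function `R` tells the maximal
half-lengths, the pseudo-centre `0` stands for an empty `90`-drome. -/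
theorem hasQuarterTurnFactorization_iff (h2 : ∀ i, turn W i ≠ 2) (hW : 0 < W.length)
    {R : ℕ → ℕ} (hR : ∀ c ∈ Finset.Ico W.length (2 * W.length), R c = arm W c) (hR0 : R 0 = 0) :
    HasQuarterTurnFactorization W ↔ ∃ c ∈ Finset.Ico W.length (2 * W.length),
      PalOn W c W.length ∨ ∃ x, (x = 0 ∨ x ∈ Finset.Ico W.length (2 * W.length) ∧
        (x + R x) % W.length = (c - R c) % W.length) ∧ 2 * R c + 2 * R x ≤ W.length ∧
        PalOn W (c + R c) (W.length - 2 * R c - 2 * R x) := by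
  constructor
  · intro h
    obtain ⟨p, l, s, r, hA, hB, hC, hn⟩ := exists_factors h
    -- one nonempty drome, with centre `p + t`, preceded by the palindrome
    have hone : ∀ (p : ℤ) (l t : ℕ), PalOn W (p - l) l → 1 ≤ t → Matches W (p + t) t →
        l + 2 * t = W.length → ∃ c ∈ Finset.Ico W.length (2 * W.length),
          2 * R c + 2 * R 0 ≤ W.length ∧ PalOn W (c + R c) (W.length - 2 * R c - 2 * R 0) := by
      intro p l t hA ht hC hn
      obtain ⟨c, hc, u, hu⟩ := exists_representative hW (p + t)
      have hRc : R c = t := by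
        rw [hR c hc, hu, arm_add_mul, arm_eq_of_factorization hA ht hC hn]
      refine ⟨c, hc, by omega, ?_⟩
      rw [hRc, hR0, show W.length - 2 * t - 2 * 0 = l by omega, hu,
        show p + t + W.length * u + t = (p - l) + W.length * (u + 1) by
          rw [← hn]; push_cast; ring, palOn_add_mul]
      exact hA
    rcases Nat.eq_zero_or_pos s with rfl | hs
    · rcases Nat.eq_zero_or_pos r with rfl | hr
      · obtain ⟨c, hc, u, hu⟩ := exists_representative hW (p - l)
        refine ⟨c, hc, .inl ?_⟩
        rw [hu, palOn_add_mul, ← hn]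
        exact hA
      · obtain ⟨c, hc, h⟩ := hone p l r hA hr (by simpa using hC) (by omega)
        exact ⟨c, hc, .inr ⟨0, .inl rfl, h⟩⟩
    · rcases Nat.eq_zero_or_pos r with rfl | hr
      · obtain ⟨c, hc, h⟩ := hone p l s hA hs hB (by omega)
        exact ⟨c, hc, .inr ⟨0, .inl rfl, h⟩⟩
      · obtain ⟨hs', hr'⟩ := arms_eq_of_factorization h2 hA hs hr hB hC hn
        obtain ⟨x, hx, u, hu⟩ := exists_representative hW (p + s)
        obtain ⟨c, hc, v, hv⟩ := exists_representative hW (p + 2 * s + r)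
        have hRx : R x = s := by rw [hR x hx, hu, arm_add_mul, hs']
        have hRc : R c = r := by rw [hR c hc, hv, arm_add_mul, hr']
        refine ⟨c, hc, .inr ⟨x, .inr ⟨hx, ?_⟩, by omega, ?_⟩⟩
        · rw [hRx, hRc]
          refine (Nat.modEq_iff_dvd).mpr ⟨v - u, ?_⟩
          rw [Finset.mem_Ico] at hc
          rw [Nat.cast_sub (by omega), Nat.cast_add, hu, hv]
          ring
        · rw [hRx, hRc, show W.length - 2 * r - 2 * s = l by omega, hv,
            show p + 2 * s + r + W.length * v + r = (p - l) + W.length * (v + 1) by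
              rw [← hn]; push_cast; ring, palOn_add_mul]
          exact hA
  · rintro ⟨c, hc, h | ⟨x, hx, hle, hpal⟩⟩
    · refine ⟨win W c W.length, [], [], ?_, (palindrome_win_iff _ _).mpr h, ⟨[], rfl⟩, ⟨[], rfl⟩⟩
      simpa using isRotated_win hW c
    · have hC : Matches W c (R c) := by rw [hR c hc]; exact matches_arm W c
      obtain ⟨l, hl⟩ : ∃ l, l = W.length - 2 * R c - 2 * R x := ⟨_, rfl⟩
      rw [← hl] at hpal
      refine ⟨win W (c + R c) l, win W (c + R c + l) (2 * R x),
        win W (c + R c + l + (2 * R x : ℕ)) (2 * R c), ?_, (palindrome_win_iff _ _).mpr hpal,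
        ?_, ?_⟩
      · have := isRotated_win hW (c + R c)
        rw [show W.length = l + 2 * R x + 2 * R c by omega, win_add, win_add] at this
        simpa [add_assoc] using this
      · rcases hx with rfl | ⟨hx, hmod⟩
        · rw [hR0]
          exact ⟨[], rfl⟩
        · have hB : Matches W x (R x) := by rw [hR x hx]; exact matches_arm W x
          obtain ⟨q, hq⟩ := (Nat.modEq_iff_dvd).mp hmod
          have hcR : R c ≤ c := by rw [Finset.mem_Ico] at hc; omega
          rw [Nat.cast_sub hcR, Nat.cast_add] at hq
          have : (c : ℤ) + R c + l = (x - R x) + W.length * (q + 1) := by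
            have : (l : ℤ) = W.length - 2 * R c - 2 * R x := by omega
            rw [this]
            linarith
          rw [this, win_add_mul]
          exact isDrome_win hB
      · have : (c : ℤ) + R c + l + (2 * R x : ℕ) = (c - R c) + W.length * 1 := by
          have : (l : ℤ) = W.length - 2 * R c - 2 * R x := by omega
          rw [this]
          push_cast
          ring
        rw [this, win_add_mul]
        exact isDrome_win hC

end Cyclic

/-! ### Boundary words -/

lemma length_steps (p : ℤ × ℤ) (W : List Letter) : (steps p W).length = W.length := by
  induction W generalizing p with
  | nil => rfl
  | cons a W ih => simp [steps, ih]

lemma getElem_steps (W : List Letter) (p : ℤ × ℤ) (i : ℕ) (h : i < W.length) :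
    (steps p W)[i]'(by rwa [length_steps]) = (p + ((W.take i).map Letter.vec).sum, W[i]) := by
  induction W generalizing p i with
  | nil => simp at h
  | cons a W ih =>
    cases i with
    | zero => simp [steps]
    | succ i =>
      simp only [steps, List.getElem_cons_succ, List.take_succ_cons, List.map_cons, List.sum_cons]
      rw [ih (p + a.vec) i (by simpa using h), add_assoc]

lemma rightCell_opposite (q : ℤ × ℤ) (a b : Letter) (h : heading b - heading a = 2) :
    rightCell (q + a.vec) b = leftCell q a := by
  cases a <;> cases b <;> first
    | (exfalso; revert h; decide)
    | (simp [rightCell, leftCell, Letter.vec, Prod.ext_iff])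

lemma cyc_natCast {W : List Letter} {i : ℕ} (h : i < W.length) : cyc W i = W[i] := by
  have : ((i : ℤ) % (W.length : ℤ)).toNat = i := by
    rw [Int.emod_eq_of_lt (by omega) (by omega)]; simp
  rw [cyc, this, List.getD_eq_getElem]

namespace Polyomino.IsBoundaryWord

variable {P : Polyomino} {W : List Letter}

lemma length_pos (h : P.IsBoundaryWord W) : 0 < W.length := by
  obtain ⟨p, _, _, hsteps⟩ := h
  obtain ⟨c⟩ := P.connected.nonempty
  -- the right edge of a rightmost cell is on the boundary
  obtain ⟨m, hm, hmax⟩ := P.cells.exists_max_image Prod.fst ⟨c.1, c.2⟩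
  have hmem : (m + (1, 1), Letter.d) ∈ steps p W := by
    rw [hsteps]
    have e₁ : rightCell (m + (1, 1)) Letter.d = m := by simp [rightCell, Prod.ext_iff]
    have e₂ : leftCell (m + (1, 1)) Letter.d = m + (1, 0) := by simp [leftCell, Prod.ext_iff]
    rw [e₁, e₂]
    refine ⟨hm, fun hcon => ?_⟩
    have := hmax _ hcon
    simp at this
  rw [← length_steps p]
  exact List.length_pos_of_mem hmem

/-- A boundary word does not backtrack: the cell to the right of a step would be the cell to the
left of the step before. -/
lemma turn_ne_two (h : P.IsBoundaryWord W) (i : ℤ) : turn W i ≠ 2 := by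
  have hpos := h.length_pos
  obtain ⟨p, hclosed, -, hsteps⟩ := h
  intro h2
  -- the step at index `j` precedes the step at index `k`, cyclically
  have key : ∀ (j k : ℕ) (hj : j < W.length) (hk : k < W.length),
      p + ((W.take k).map Letter.vec).sum = p + ((W.take j).map Letter.vec).sum + W[j].vec →
      heading W[k] - heading W[j] ≠ 2 := by
    intro j k hj hk hjk hcon
    have mem : ∀ (m : ℕ) (hm : m < W.length),
        (p + ((W.take m).map Letter.vec).sum, W[m]) ∈ steps p W := by
      intro m hm
      rw [← getElem_steps W p m hm]
      exact List.getElem_mem _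
    have h₁ := ((hsteps _ _).mp (mem j hj)).2
    have h₂ := ((hsteps _ _).mp (mem k hk)).1
    rw [hjk, rightCell_opposite _ _ _ hcon] at h₂
    exact h₁ h₂
  have hsum : ∀ (j : ℕ) (hj : j < W.length), ((W.take (j + 1)).map Letter.vec).sum
      = ((W.take j).map Letter.vec).sum + W[j].vec := by
    intro j hj
    rw [List.take_succ_eq_append_getElem hj]
    simp only [List.map_append, List.sum_append, List.map_cons, List.map_nil, List.sum_cons,
      List.sum_nil, add_zero]
  have h₁ := Int.emod_nonneg i (b := (W.length : ℤ)) (by omega)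
  have h₂ := Int.emod_lt_of_pos i (b := (W.length : ℤ)) (by omega)
  obtain ⟨k, hk⟩ := Int.eq_ofNat_of_zero_le h₁
  have hi : i = k + W.length * (i / W.length) := by
    have := Int.emod_add_mul_ediv i W.length
    omega
  rw [turn, hi, cyc_add_mul, cyc_natCast (show k < W.length by omega),
    show (k : ℤ) + W.length * (i / W.length) - 1 = k - 1 + W.length * (i / W.length) by ring,
    cyc_add_mul] at h2
  rcases Nat.eq_zero_or_pos k with rfl | hkpos
  · have e : cyc W ((0 : ℕ) - 1) = W[W.length - 1] := by
      rw [← cyc_natCast (W := W) (show W.length - 1 < W.length by omega)]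
      rw [← cyc_add_mul _ 1]
      congr 1
      omega
    rw [e] at h2
    refine key (W.length - 1) 0 (by omega) hpos ?_ h2
    rw [add_assoc, ← hsum _ (by omega), Nat.sub_add_cancel hpos, List.take_length, hclosed]
    simp
  · obtain ⟨j, rfl⟩ : ∃ j, k = j + 1 := ⟨k - 1, by omega⟩
    have e : cyc W ((j + 1 : ℕ) - 1) = W[j]'(by omega) := by
      rw [← cyc_natCast (W := W) (show j < W.length by omega)]
      congr 1
      push_cast
      ring
    rw [e] at h2
    refine key j (j + 1) (by omega) (by omega) ?_ h2
    rw [hsum j (by omega), add_assoc]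

lemma four_le_length (h : P.IsBoundaryWord W) : 4 ≤ W.length := by
  have hpos := h.length_pos
  have hturn := h.turn_ne_two 1
  obtain ⟨p, hclosed, -, -⟩ := h
  have hsum : (W.map Letter.vec).sum = 0 := by simpa using hclosed
  match W, hpos, hturn, hsum with
  | [a], _, _, hs => cases a <;> simp [Letter.vec] at hs
  | [a, b], _, ht, hs =>
    exfalso
    have e₀ : cyc [a, b] 1 = b := rfl
    have e₁ : cyc [a, b] (1 - 1) = a := rfl
    rw [turn, e₀, e₁] at ht
    revert ht
    cases a <;> cases b <;> first | (simp [Letter.vec] at hs; done) | decide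
  | [a, b, c], _, _, hs =>
    cases a <;> cases b <;> cases c <;> simp [Letter.vec] at hs
  | _ :: _ :: _ :: _ :: _, _, _, _ => simp

end Polyomino.IsBoundaryWord

/-! ### Phases of the program -/

/-- The sum of two expressions. -/
instance : Add Term := ⟨Term.op .add⟩
/-- The truncated difference of two expressions. -/
instance : Sub Term := ⟨Term.op .sub⟩
/-- The product of two expressions. -/
instance : Mul Term := ⟨Term.op .mul⟩
/-- The quotient, rounded down of two expressions. -/
instance : Div Term := ⟨Term.op .div⟩
/-- The remainder, obtained from a product and a quotient since it is not an operation of the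
machine. -/
instance : Mod Term := ⟨fun x y => x - x / y * y⟩

namespace Term

/-- The test `x < y`. -/
def less (x y : Term) : Term := .op .lt x y

/-- The test `x = y`. -/
def equal (x y : Term) : Term := .op .eq x y

variable (s : Memory) (x y : Term)

@[simp] lemma eval_const (k : ℕ) : (const k).eval s = k := rfl
@[simp] lemma eval_reg (i : ℕ) : (reg i).eval s = s.reg i := rfl
@[simp] lemma eval_arr (a : ℕ) : (arr a x).eval s = s.arr a (x.eval s) := rfl
@[simp] lemma eval_add : (x + y).eval s = x.eval s + y.eval s := rfl
@[simp] lemma eval_sub : (x - y).eval s = x.eval s - y.eval s := rfl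
@[simp] lemma eval_mul : (x * y).eval s = x.eval s * y.eval s := rfl
@[simp] lemma eval_div : (x / y).eval s = x.eval s / y.eval s := rfl
@[simp] lemma eval_mod : (x % y).eval s = x.eval s % y.eval s :=
  (Nat.mod_eq_sub_div_mul ..).symm
@[simp] lemma eval_less : (less x y).eval s = if x.eval s < y.eval s then 1 else 0 := rfl
@[simp] lemma eval_equal : (equal x y).eval s = if x.eval s = y.eval s then 1 else 0 := rfl

end Term

namespace Program

/-- A time bound per unit of `n` for a program made of a loop-free part and a loop with a loop-free
body that makes at most `C * n` passes. -/
def phaseBound (C : ℕ) : Program → ℕ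
  | seq setup (loop e body) => setup.maxCost + (C + 1) * (e.cost + 1 + body.maxCost)
  | _ => 0

/-- A loop of at most `C * n` passes after a loop-free part takes linear time; `1 ≤ n` absorbs the
constant terms. -/
lemma Reaches.phase {M n C : ℕ} {e : Term} {setup body : Program} {s : Memory}
    (I : Memory → Prop) (μ : Memory → ℕ) (hn : 1 ≤ n)
    (hsafe : setup.Safe M s) (hI : I (setup.exec s)) (hμ : μ (setup.exec s) ≤ C * n)
    (hstep : ∀ s, I s → e.eval s ≠ 0 → body.Safe M s ∧ I (body.exec s) ∧ μ (body.exec s) < μ s) :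
    (Program.seq setup (.loop e body)).Reaches M s
      (phaseBound C (.seq setup (.loop e body)) * n)
      (fun s' => I s' ∧ e.eval s' = 0) := by
  refine ((Reaches.of_safe (Q := fun s' => s' = setup.exec s) hsafe rfl).seq
    (T₂ := (C * n + 1) * (e.cost + 1 + body.maxCost))
    (Q := fun s' => I s' ∧ e.eval s' = 0) ?_).mono ?_ (fun _ h => h)
  · rintro _ rfl
    exact Reaches.loop I μ hstep hI hμ
  · rw [phaseBound]
    have h₁ : setup.maxCost * 1 ≤ setup.maxCost * n := Nat.mul_le_mul_left _ hn
    have h₂ : (C * n + 1) * (e.cost + 1 + body.maxCost)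
        ≤ ((C + 1) * n) * (e.cost + 1 + body.maxCost) := Nat.mul_le_mul_right _ (by linarith)
    calc _ ≤ setup.maxCost * n + ((C + 1) * n) * (e.cost + 1 + body.maxCost) := by omega
      _ = _ := by ring

end Program

open Program Term

/-- Computes in register `1` the largest `b` with `4 ^ b ≤ n`, and `4 ^ b` in register `2`. -/
def blockProgram : Program :=
  .seq (.seq (.assign 1 (const 0)) (.assign 2 (const 1)))
    (.loop (less (const 4 * reg 2) (reg 0 + const 1))
      (.seq (.assign 2 (const 4 * reg 2)) (.assign 1 (reg 1 + const 1))))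

lemma blockProgram_spec {n M : ℕ} {s : Memory} (hn : 1 ≤ n) (hM : 16 * n ≤ M) (hs : s.reg 0 = n) :
    blockProgram.Reaches M s (blockProgram.phaseBound 1 * n) (fun s' =>
      s'.reg 0 = n ∧ s'.arr = s.arr ∧
      s'.reg 2 = 4 ^ s'.reg 1 ∧ s'.reg 2 ≤ n ∧ n < 4 * s'.reg 2) := by
  refine (Reaches.phase (C := 1) (fun s' => s'.reg 0 = n ∧ s'.arr = s.arr ∧
      s'.reg 2 = 4 ^ s'.reg 1 ∧ s'.reg 2 ≤ n) (fun s' => n - s'.reg 2) hn ?_ ?_ ?_ ?_).mono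
    le_rfl ?_
  · simp [Safe, exec]; omega
  · simp [exec, hs]; omega
  · simp
  · rintro s ⟨h₀, ha, h₂, hle⟩ he
    have hlt : s.reg 1 < 4 ^ s.reg 1 := Nat.lt_pow_self (by norm_num)
    simp [h₀] at he
    simp [Safe, exec, h₀, ha, h₂, pow_succ]
    omega
  · rintro s' ⟨⟨h₀, ha, h₂, hle⟩, he⟩
    simp [h₀] at he
    exact ⟨h₀, ha, h₂, hle, by omega⟩

/-- `v` is the number of trailing zeros of `x` in base four. -/
def IsVal (x v : ℕ) : Prop := 4 ^ v ∣ x ∧ ¬ 4 ^ (v + 1) ∣ x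

/-- Tabulates in array `1` the number of trailing zeros in base four for `0 < x < 4 ^ b`. -/
def tableProgram : Program :=
  .seq (.assign 3 (const 1))
    (.loop (less (reg 3) (reg 2))
      (.seq (.ite (reg 3 % const 4) (.store 1 (reg 3) (const 0))
          (.store 1 (reg 3) (arr 1 (reg 3 / const 4) + const 1)))
        (.assign 3 (reg 3 + const 1))))

lemma IsVal.lt {x v : ℕ} (h : IsVal x v) (hx : 0 < x) : v < x :=
  (Nat.lt_pow_self (by norm_num)).trans_le (Nat.le_of_dvd hx h.1)

lemma isVal_zero {x : ℕ} (h : x % 4 ≠ 0) : IsVal x 0 := by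
  refine ⟨by simp, fun h' => h ?_⟩
  simpa [Nat.dvd_iff_mod_eq_zero] using h'

lemma IsVal.four_mul {x v : ℕ} (h : IsVal x v) : IsVal (4 * x) (v + 1) := by
  refine ⟨?_, fun h' => h.2 ?_⟩
  · rw [pow_succ, mul_comm]
    exact Nat.mul_dvd_mul_left 4 h.1
  · rw [pow_succ _ (v + 1), mul_comm] at h'
    exact Nat.dvd_of_mul_dvd_mul_left (by norm_num) h'

lemma tableProgram_spec {n M : ℕ} {s : Memory} (hn : 1 ≤ n) (hM : 16 * n ≤ M) (hs : s.reg 2 ≤ n) :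
    tableProgram.Reaches M s (tableProgram.phaseBound 1 * n) (fun s' =>
      (∀ i < 3, s'.reg i = s.reg i) ∧
      (∀ a ≠ 1, ∀ x, s'.arr a x = s.arr a x) ∧
      (∀ x, 0 < x → x < s.reg 2 → IsVal x (s'.arr 1 x))) := by
  refine (Reaches.phase (C := 1) (fun s' => (∀ i < 3, s'.reg i = s.reg i) ∧
      (∀ a ≠ 1, ∀ x, s'.arr a x = s.arr a x) ∧ 1 ≤ s'.reg 3 ∧
      (∀ x, 0 < x → x < s'.reg 3 → IsVal x (s'.arr 1 x))) (fun s' => s.reg 2 - s'.reg 3)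
      hn ?_ ?_ ?_ ?_).mono le_rfl ?_
  · simp [Safe]; omega
  · refine ⟨fun i hi => ?_, fun a ha x => by simp [exec], by simp [exec], ?_⟩
    · simp [exec]; omega
    · intro x h₁ h₂; simp [exec] at h₂; omega
  · simp [exec]; omega
  · rintro s' ⟨hreg, harr, h₃, hval⟩ he
    have h₂ := hreg 2 (by norm_num)
    simp [h₂] at he
    have hnext : IsVal (s'.reg 3)
        (if s'.reg 3 % 4 ≠ 0 then 0 else s'.arr 1 (s'.reg 3 / 4) + 1) := by
      split_ifs with h
      · exact isVal_zero h
      · have := (hval (s'.reg 3 / 4) (by omega) (by omega)).four_mul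
        rwa [show 4 * (s'.reg 3 / 4) = s'.reg 3 by omega] at this
    have hlt := hnext.lt (by omega)
    by_cases h : s'.reg 3 % 4 = 0
    · rw [if_neg (by simpa using h)] at hnext hlt
      simp [Safe, exec, h]
      refine ⟨by omega, ⟨fun i hi => ?_, fun a ha x => ?_, ?_⟩, by omega⟩
      · rw [if_neg (by omega)]; exact hreg i hi
      · rw [if_neg ha]; exact harr a ha x
      · intro x hx hx'
        split_ifs with hxe
        · rw [hxe]; exact hnext
        · exact hval x hx (by omega)
    · rw [if_pos (by simpa using h)] at hnext hlt
      simp [Safe, exec, h]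
      refine ⟨by omega, ⟨fun i hi => ?_, fun a ha x => ?_, ?_⟩, by omega⟩
      · rw [if_neg (by omega)]; exact hreg i hi
      · rw [if_neg ha]; exact harr a ha x
      · intro x hx hx'
        split_ifs with hxe
        · rw [hxe]; exact hnext
        · exact hval x hx (by omega)
  · rintro s' ⟨⟨hreg, harr, h₃, hval⟩, he⟩
    have h₂ := hreg 2 (by norm_num)
    simp [h₂] at he
    exact ⟨hreg, harr, fun x h₁ h₂ => hval x h₁ (by omega)⟩

/-! ### Packed blocks of letters -/

/-- The number with base four digits `f 0, f 1, …, f (m - 1)`, the lowest first. -/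
def pack : (ℕ → ℕ) → ℕ → ℕ
  | _, 0 => 0
  | f, m + 1 => f 0 + 4 * pack (fun j => f (j + 1)) m

lemma pack_congr {f g : ℕ → ℕ} {m : ℕ} (h : ∀ j < m, f j = g j) : pack f m = pack g m := by
  induction m generalizing f g with
  | zero => rfl
  | succ m ih => rw [pack, pack, h 0 (by omega), ih fun j hj => h (j + 1) (by omega)]

lemma pack_eq_iff {f g : ℕ → ℕ} (hf : ∀ j, f j < 4) (hg : ∀ j, g j < 4) (m : ℕ) :
    pack f m = pack g m ↔ ∀ j < m, f j = g j := by
  refine ⟨fun h => ?_, pack_congr⟩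
  induction m generalizing f g with
  | zero => intro j hj; omega
  | succ m ih =>
    have hf₀ := hf 0
    have hg₀ := hg 0
    rw [pack, pack] at h
    intro j hj
    rcases j with _ | j
    · omega
    · exact ih (fun j => hf (j + 1)) (fun j => hg (j + 1)) (by omega) j (by omega)

/-- The first `k` base four digits of `X` are given by `f`. -/
def Packed (f : ℕ → ℕ) (k X : ℕ) : Prop := ∀ m ≤ k, X % 4 ^ m = pack f m

/-- A letter is put in front of a packed block, and the last letter of the block is dropped. -/
lemma Packed.cons {f g : ℕ → ℕ} {k b X v : ℕ} (h : Packed f k X) (hv : v < 4) (h₀ : g 0 = v)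
    (hs : ∀ j < k, g (j + 1) = f j) :
    Packed g (min b (k + 1)) (v + 4 * (X % 4 ^ (b - 1))) := by
  intro m hm
  rcases m with _ | m
  · simp [pack, Nat.mod_one]
  · rw [pack, h₀, pack_congr fun j hj => hs j (by omega), ← h m (by omega),
      ← Nat.mod_mod_of_dvd X (show 4 ^ m ∣ 4 ^ (b - 1) from pow_dvd_pow _ (by omega))]
    generalize X % 4 ^ (b - 1) = Y
    have hlt : Y % 4 ^ m < 4 ^ m := Nat.mod_lt _ (by positivity)
    have hY := Nat.div_add_mod Y (4 ^ m)
    have e : v + 4 * Y = v + 4 * (Y % 4 ^ m) + 4 ^ (m + 1) * (Y / 4 ^ m) := by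
      rw [pow_succ]
      nlinarith
    rw [e, Nat.add_mul_mod_self_left, Nat.mod_eq_of_lt (by rw [pow_succ]; omega)]

lemma add_four_mul_mod_lt {b v X : ℕ} (hb : 1 ≤ b) (hv : v < 4) :
    v + 4 * (X % 4 ^ (b - 1)) < 4 ^ b := by
  have h : X % 4 ^ (b - 1) < 4 ^ (b - 1) := Nat.mod_lt _ (by positivity)
  have e : 4 ^ b = 4 ^ (b - 1) * 4 := by rw [← pow_succ, Nat.sub_add_cancel hb]
  omega

/-- The letters from position `i` on. -/
def ahead (a : ℕ → ℕ) (i j : ℕ) : ℕ := a (i + j)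

/-- The letters before position `i`, read backwards and rotated. -/
def behind (a : ℕ → ℕ) (i j : ℕ) : ℕ := (a (i - 1 - j) + 3) % 4

/-- Stores in array `2` the packed blocks of letters from each position on, and in array `3` those
of the rotated letters before each position. -/
def packProgram : Program :=
  .seq (.seq (.assign 3 (const 0)) (.seq (.assign 4 (const 0)) (.assign 5 (const 0))))
    (.loop (less (reg 3) (const 3 * reg 0))
      (.seq (.store 3 (reg 3) (reg 5))
      (.seq (.assign 5 ((arr 0 (reg 3 % reg 0) + const 3) % const 4
        + const 4 * (reg 5 % (reg 2 / const 4))))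
      (.seq (.assign 4 (arr 0 ((const 3 * reg 0 - const 1 - reg 3) % reg 0)
        + const 4 * (reg 4 % (reg 2 / const 4))))
      (.seq (.store 2 (const 3 * reg 0 - const 1 - reg 3) (reg 4))
        (.assign 3 (reg 3 + const 1)))))))

lemma packProgram_spec {n M b : ℕ} {s : Memory} {a : ℕ → ℕ} (hn : 1 ≤ n) (hM : 16 * n ≤ M)
    (h₀ : s.reg 0 = n) (h₂ : s.reg 2 = 4 ^ b) (hb : 1 ≤ b) (hbn : 4 ^ b ≤ n)
    (ha : ∀ i, s.arr 0 (i % n) = a i) (ha4 : ∀ i, a i < 4) :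
    packProgram.Reaches M s (packProgram.phaseBound 3 * n) (fun s' =>
      (∀ i < 3, s'.reg i = s.reg i) ∧ (∀ k, k ≠ 2 → k ≠ 3 → ∀ x, s'.arr k x = s.arr k x) ∧
      (∀ i < 3 * n, s'.arr 3 i < 4 ^ b ∧ Packed (behind a i) (min b i) (s'.arr 3 i)) ∧
      (∀ i < 3 * n, s'.arr 2 i < 4 ^ b ∧ Packed (ahead a i) (min b (3 * n - i)) (s'.arr 2 i))) := by
  have hpos : 0 < 4 ^ b := by positivity
  have hdiv : 4 ^ b / 4 = 4 ^ (b - 1) := by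
    rw [← Nat.sub_add_cancel hb, pow_succ]; simp
  refine (Reaches.phase (C := 3) (fun s' =>
      ((∀ i < 3, s'.reg i = s.reg i) ∧ (∀ k, k ≠ 2 → k ≠ 3 → ∀ x, s'.arr k x = s.arr k x)) ∧
      s'.reg 3 ≤ 3 * n ∧
      (s'.reg 5 < 4 ^ b ∧ Packed (behind a (s'.reg 3)) (min b (s'.reg 3)) (s'.reg 5)) ∧
      (s'.reg 4 < 4 ^ b ∧ Packed (ahead a (3 * n - s'.reg 3)) (min b (s'.reg 3)) (s'.reg 4)) ∧
      (∀ i < s'.reg 3, s'.arr 3 i < 4 ^ b ∧ Packed (behind a i) (min b i) (s'.arr 3 i)) ∧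
      (∀ i < 3 * n, 3 * n - s'.reg 3 ≤ i →
        s'.arr 2 i < 4 ^ b ∧ Packed (ahead a i) (min b (3 * n - i)) (s'.arr 2 i)))
    (fun s' => 3 * n - s'.reg 3) hn ?_ ?_ ?_ ?_).mono le_rfl ?_
  · simp [Safe, exec]; omega
  · have hz : ∀ f, Packed f 0 0 := by
      intro f m hm
      obtain rfl : m = 0 := by omega
      simp [pack]
    refine ⟨⟨fun i hi => ?_, fun k _ _ x => by simp [exec]⟩, by simp [exec], ?_, ?_, ?_, ?_⟩
    · simp [exec]
      rw [if_neg (by omega), if_neg (by omega), if_neg (by omega)]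
    · simp [exec, hz]
    · simp [exec, hz]
    · simp [exec]
    · simp [exec]; omega
  · simp [exec]
  · rintro s' ⟨⟨hreg, harr⟩, hle, ⟨h5lt, h5⟩, ⟨h4lt, h4⟩, hG, hF⟩ he
    have r₀ : s'.reg 0 = n := by rw [hreg 0 (by norm_num), h₀]
    have r₂ : s'.reg 2 = 4 ^ b := by rw [hreg 2 (by norm_num), h₂]
    have hin : ∀ i, s'.arr 0 (i % n) = a i := by
      intro i; rw [harr 0 (by norm_num) (by norm_num), ha]
    simp [r₀] at he
    obtain ⟨t, ht⟩ : ∃ t, t = s'.reg 3 := ⟨_, rfl⟩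
    rw [← ht] at he hle h5 h4 hG hF
    have hv5 : (a t + 3) % 4 < 4 := Nat.mod_lt _ (by norm_num)
    have hv4 := ha4 (3 * n - 1 - t)
    have new5 := h5.cons (b := b) (g := behind a (t + 1)) hv5 (by simp [behind])
      (fun j _ => by simp only [behind]; congr 3; omega)
    have new4 := h4.cons (b := b) (g := ahead a (3 * n - (t + 1))) hv4
      (by simp only [ahead]; congr 1; omega)
      (fun j _ => by simp only [ahead]; congr 1; omega)
    rw [show min b (min b t + 1) = min b (t + 1) by omega] at new5 new4
    have lt5 := add_four_mul_mod_lt (X := s'.reg 5) hb hv5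
    have lt4 := add_four_mul_mod_lt (X := s'.reg 4) hb hv4
    simp [Safe, exec, r₀, r₂, hin, hdiv, ← ht]
    refine ⟨by omega, ⟨⟨fun i hi => ?_, fun k hk₂ hk₃ x => ?_⟩, by omega, ⟨lt5, new5⟩,
      ⟨lt4, new4⟩, fun i hi => ?_, fun i hi hi' => ?_⟩, by omega⟩
    · rw [if_neg (by omega), if_neg (by omega), if_neg (by omega)]
      exact hreg i hi
    · rw [if_neg hk₂, if_neg hk₃]
      exact harr k hk₂ hk₃ x
    · split_ifs with h
      · rw [h]; exact ⟨h5lt, h5⟩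
      · exact hG i (by omega)
    · split_ifs with h
      · rw [h, show 3 * n - (3 * n - 1 - t) = t + 1 by omega,
          show 3 * n - 1 - t = 3 * n - (t + 1) by omega]
        rw [show 3 * n - 1 - t = 3 * n - (t + 1) by omega] at lt4 new4
        exact ⟨lt4, new4⟩
      · exact hF i hi (by omega)
  · rintro s' ⟨⟨⟨hreg, harr⟩, hle, -, -, hG, hF⟩, he⟩
    have r₀ : s'.reg 0 = n := by rw [hreg 0 (by norm_num), h₀]
    simp [r₀] at he
    exact ⟨hreg, harr, fun i hi => hG i (by omega), fun i hi => hF i hi (by omega)⟩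

/-! ### Computation of the maximal arms -/

/-- The codes of the letters of a circular word. -/
def codes (W : List Letter) (i : ℕ) : ℕ := (cyc W i).code

lemma code_lt_four (x : Letter) : x.code < 4 := by cases x <;> decide

lemma code_injective : Function.Injective Letter.code := by
  intro x y h
  cases x <;> cases y <;> first | rfl | (revert h; decide)

lemma code_rot_three (x : Letter) : (x.rot 3).code = (x.code + 3) % 4 := by
  cases x <;> decide

section Blocks

variable {W : List Letter}

lemma matches_add_iff {c r m : ℕ} (h : Matches W c r) (hm : r + m ≤ c) :
    Matches W c (r + m) ↔
      ∀ j < m, ahead (codes W) (c + r) j = behind (codes W) (c - r) j := by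
  have key : ∀ j, j < m → (cyc W (c + (r + j : ℕ)) = (cyc W (c - 1 - (r + j : ℕ))).rot 3 ↔
      ahead (codes W) (c + r) j = behind (codes W) (c - r) j) := by
    intro j hj
    have e₁ : (c : ℤ) + (r + j : ℕ) = (c + r + j : ℕ) := by omega
    have e₂ : (c : ℤ) - 1 - (r + j : ℕ) = (c - r - 1 - j : ℕ) := by omega
    rw [e₁, e₂, ahead, behind, codes, codes, ← code_rot_three, code_injective.eq_iff]
  constructor
  · intro h' j hj
    exact (key j hj).mp (h' (r + j) (by omega))
  · intro h' j hj
    by_cases hjr : j < r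
    · exact h j hjr
    · obtain ⟨i, rfl⟩ : ∃ i, j = r + i := ⟨j - r, by omega⟩
      exact (key i (by omega)).mpr (h' i (by omega))

/-- Two numbers agree on their last `v` digits if and only if `4 ^ v` divides their distance. -/
lemma four_pow_dvd_dist_iff {X Y v : ℕ} : 4 ^ v ∣ (X - Y) + (Y - X) ↔ X % 4 ^ v = Y % 4 ^ v := by
  rcases le_total X Y with h | h
  · rw [Nat.sub_eq_zero_of_le h, zero_add]
    exact (Nat.modEq_iff_dvd' h).symm
  · rw [Nat.sub_eq_zero_of_le h, add_zero]
    exact (Nat.modEq_iff_dvd' h).symm.trans eq_comm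

/-- The comparison of two packed blocks decides how far the `90`-drome around `c` extends. -/
lemma matches_add_iff_mod {c r b X Y : ℕ} (h : Matches W c r) (hc : r + b ≤ c)
    (hX : Packed (ahead (codes W) (c + r)) b X) (hY : Packed (behind (codes W) (c - r)) b Y)
    {m : ℕ} (hm : m ≤ b) : Matches W c (r + m) ↔ X % 4 ^ m = Y % 4 ^ m := by
  rw [matches_add_iff h (by omega), hX m hm, hY m hm, pack_eq_iff]
  · exact fun j => code_lt_four _
  · exact fun j => Nat.mod_lt _ (by norm_num)

lemma arm_eq_of_isVal {c r b X Y v : ℕ} (h : Matches W c r) (hc : r + b ≤ c)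
    (hX : Packed (ahead (codes W) (c + r)) b X) (hY : Packed (behind (codes W) (c - r)) b Y)
    (hvb : v < b) (hv : IsVal ((X - Y) + (Y - X)) v) :
    arm W c = min (W.length / 2) (r + v) := by
  have h₁ : Matches W c (r + v) :=
    (matches_add_iff_mod h hc hX hY hvb.le).mpr (four_pow_dvd_dist_iff.mp hv.1)
  have h₂ : ¬ Matches W c (r + (v + 1)) := fun h' =>
    hv.2 (four_pow_dvd_dist_iff.mpr ((matches_add_iff_mod h hc hX hY hvb).mp h'))
  have h₃ := two_mul_arm_le W c
  have h₄ : arm W c ≤ r + v := by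
    by_contra hcon
    exact h₂ ((matches_arm W c).mono (by omega))
  have h₅ := le_arm (h₁.mono (min_le_right (W.length / 2) _)) (by omega)
  omega

end Blocks

/-- The largest `x` in `[n, c)` with `key x = j`, or `0` if there is none. -/
def lastBefore (key : ℕ → ℕ) (n j c : ℕ) : ℕ :=
  ((Finset.Ico n c).filter fun x => key x = j).sup id

lemma lastBefore_self (key : ℕ → ℕ) (n j : ℕ) : lastBefore key n j n = 0 := by
  simp [lastBefore]

lemma lastBefore_mem {key : ℕ → ℕ} {n j c : ℕ} (h : lastBefore key n j c ≠ 0) :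
    n ≤ lastBefore key n j c ∧ lastBefore key n j c < c ∧ key (lastBefore key n j c) = j := by
  have hne : ((Finset.Ico n c).filter fun x => key x = j).Nonempty := by
    by_contra hcon
    rw [Finset.not_nonempty_iff_eq_empty] at hcon
    exact h (by rw [lastBefore, hcon]; rfl)
  obtain ⟨x, hx, hxe⟩ := Finset.exists_mem_eq_sup _ hne id
  rw [lastBefore, hxe]
  rw [Finset.mem_filter, Finset.mem_Ico] at hx
  exact ⟨hx.1.1, hx.1.2, hx.2⟩

lemma le_lastBefore {key : ℕ → ℕ} {n j c x : ℕ} (hn : n ≤ x) (hc : x < c) (hx : key x = j) :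
    x ≤ lastBefore key n j c :=
  Finset.le_sup (f := id) (by simp [hn, hc, hx])

lemma lastBefore_succ {key : ℕ → ℕ} {n j c : ℕ} (h : n ≤ c) :
    lastBefore key n j (c + 1) = if key c = j then c else lastBefore key n j c := by
  have hins : Finset.Ico n (c + 1) = insert c (Finset.Ico n c) := by
    ext x; simp only [Finset.mem_Ico, Finset.mem_insert]; omega
  rw [lastBefore, hins, Finset.filter_insert]
  split_ifs with hk
  · rw [Finset.sup_insert]
    refine sup_eq_left.mpr (Finset.sup_le fun x hx => ?_)
    rw [Finset.mem_filter, Finset.mem_Ico] at hx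
    exact hx.1.2.le
  · rfl

lemma lastBefore_le (key : ℕ → ℕ) (n j c : ℕ) : lastBefore key n j c ≤ c := by
  by_cases h : lastBefore key n j c = 0
  · omega
  · exact (lastBefore_mem h).2.1.le

/-- The position, modulo `n`, where the maximal `90`-drome with centre `x` ends. -/
noncomputable def endKey (W : List Letter) (x : ℕ) : ℕ := (x + arm W x) % W.length

/-- Computes in array `4` the maximal arms of the centres in `[n, 2 n)`, block by block, and links
the centres whose `90`-dromes end at the same place: array `5` holds the heads of the linked lists
and array `6` the links. -/
def armProgram : Program :=
  .seq (.seq (.assign 3 (reg 0)) (.assign 6 (const 0)))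
    (.loop (less (reg 3) (const 2 * reg 0))
      (.ite (less (reg 6) (reg 0 / const 2) *
          equal (arr 2 (reg 3 + reg 6)) (arr 3 (reg 3 - reg 6)))
        (.assign 6 (reg 6 + reg 1))
        (.seq (.assign 7 (reg 0 / const 2 - (reg 0 / const 2 - (reg 6 +
          arr 1 ((arr 2 (reg 3 + reg 6) - arr 3 (reg 3 - reg 6)) +
            (arr 3 (reg 3 - reg 6) - arr 2 (reg 3 + reg 6)))))))
        (.seq (.store 4 (reg 3) (reg 7))
        (.seq (.assign 7 ((reg 3 + reg 7) % reg 0))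
        (.seq (.store 6 (reg 3) (arr 5 (reg 7)))
        (.seq (.store 5 (reg 7) (reg 3))
        (.seq (.assign 3 (reg 3 + const 1)) (.assign 6 (const 0))))))))))

/-- The total number of blocks of `b ≈ log n` letters in all arms is linear in `n`. -/
lemma sum_arm_div_le {W : List Letter} (h2 : ∀ i, turn W i ≠ 2) {b : ℕ} (hb : 1 ≤ b)
    (hn : W.length < 4 * 4 ^ b) :
    ∑ c ∈ Finset.Ico W.length (2 * W.length), (arm W c / b + 3) ≤ 51 * W.length := by
  have h := sum_arm_le h2 (isArmFunction_arm W) (fun c => two_mul_arm_le W c) (L := 2 * b + 2)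
    (by rw [pow_add, pow_mul]; norm_num; omega)
  have h₁ : b * ∑ c ∈ Finset.Ico W.length (2 * W.length), (arm W c / b) ≤ b * (48 * W.length) := by
    rw [Finset.mul_sum]
    calc ∑ c ∈ Finset.Ico W.length (2 * W.length), b * (arm W c / b)
        ≤ ∑ c ∈ Finset.Ico W.length (2 * W.length), arm W c :=
          Finset.sum_le_sum fun c _ => Nat.mul_div_le _ _
      _ ≤ 12 * W.length * (2 * b + 2) := h
      _ ≤ b * (48 * W.length) := by nlinarith
  have h₂ := Nat.le_of_mul_le_mul_left h₁ (by omega)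
  have h₃ : ∑ c ∈ Finset.Ico W.length (2 * W.length), 3 = 3 * W.length := by
    simp [mul_comm]; omega
  rw [Finset.sum_add_distrib, h₃]
  omega

lemma armProgram_spec {W : List Letter} {n M b : ℕ} {s : Memory} (h2 : ∀ i, turn W i ≠ 2)
    (hW : W.length = n) (hn : 4 ≤ n) (hM : 16 * n ≤ M)
    (h₀ : s.reg 0 = n) (h₁ : s.reg 1 = b) (hb : 1 ≤ b) (hbn : 4 ^ b ≤ n) (hnb : n < 4 * 4 ^ b)
    (hT : ∀ x, 0 < x → x < 4 ^ b → IsVal x (s.arr 1 x))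
    (hG : ∀ i < 3 * n, s.arr 3 i < 4 ^ b ∧ Packed (behind (codes W) i) (min b i) (s.arr 3 i))
    (hF : ∀ i < 3 * n, s.arr 2 i < 4 ^ b ∧
      Packed (ahead (codes W) i) (min b (3 * n - i)) (s.arr 2 i))
    (hR0 : s.arr 4 0 = 0) (hhead : ∀ j, s.arr 5 j = 0) :
    armProgram.Reaches M s (armProgram.phaseBound 51 * n) (fun s' =>
      s'.reg 0 = n ∧ (∀ x, s'.arr 0 x = s.arr 0 x) ∧ s'.arr 4 0 = 0 ∧
      (∀ x, n ≤ x → x < 2 * n → s'.arr 4 x = arm W x) ∧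
      (∀ j, s'.arr 5 j = lastBefore (endKey W) n j (2 * n)) ∧
      (∀ x, n ≤ x → x < 2 * n → s'.arr 6 x = lastBefore (endKey W) n (endKey W x) x)) := by
  have hb2 : 2 * b ≤ n := by
    have : ∀ b, 2 * b ≤ 4 ^ b := by
      intro b
      induction b with
      | zero => simp
      | succ b ih => rw [pow_succ]; have : 0 < 4 ^ b := by positivity
                     omega
    have := this b
    omega
  refine (Reaches.phase (C := 51) (fun s' =>
      (s'.reg 0 = n ∧ s'.reg 1 = b ∧ (∀ k < 4, ∀ x, s'.arr k x = s.arr k x) ∧ s'.arr 4 0 = 0) ∧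
      (n ≤ s'.reg 3 ∧ s'.reg 3 ≤ 2 * n) ∧
      (Matches W (s'.reg 3) (s'.reg 6) ∧
        ∃ q, s'.reg 6 = b * q ∧ q ≤ arm W (s'.reg 3) / b + 1) ∧
      (∀ x, n ≤ x → x < s'.reg 3 → s'.arr 4 x = arm W x) ∧
      (∀ j, s'.arr 5 j = lastBefore (endKey W) n j (s'.reg 3)) ∧
      (∀ x, n ≤ x → x < s'.reg 3 → s'.arr 6 x = lastBefore (endKey W) n (endKey W x) x))
    -- a pass consumes a whole block of the current arm or settles the current centre
    (fun s' => ∑ c ∈ Finset.Ico (s'.reg 3) (2 * n), (arm W c / b + 3) - s'.reg 6 / b)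
    (by omega) ?_ ?_ ?_ ?_).mono le_rfl ?_
  · simp [Safe, exec, h₀]; omega
  · refine ⟨⟨by simp [exec, h₀], by simp [exec, h₁], fun k _ x => by simp [exec],
      by simp [exec, hR0]⟩, ⟨by simp [exec, h₀], by simp [exec, h₀]; omega⟩,
      ⟨fun j hj => by simp [exec] at hj, 0, by simp [exec], Nat.zero_le _⟩, ?_, ?_, ?_⟩
    · intro x hx hx'; simp [exec, h₀] at hx'; omega
    · intro j; simp [exec, h₀, hhead, lastBefore_self]
    · intro x hx hx'; simp [exec, h₀] at hx'; omega
  · have := sum_arm_div_le h2 hb (by omega)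
    rw [hW] at this
    simpa [exec, h₀] using this
  · rintro s' ⟨⟨r₀, r₁, harr, hR0'⟩, ⟨hcn, hc2⟩, ⟨hmat, q, hq, hqle⟩, hR, hhd, hnx⟩ he
    simp [r₀] at he
    obtain ⟨c, hc⟩ : ∃ c, c = s'.reg 3 := ⟨_, rfl⟩
    obtain ⟨r, hr⟩ : ∃ r, r = s'.reg 6 := ⟨_, rfl⟩
    rw [← hc] at hcn hc2 hmat hR hhd hnx he hqle
    rw [← hr] at hmat hq
    have hrb : r / b = q := by rw [hq, Nat.mul_div_cancel_left _ (by omega)]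
    have hsum : ∑ x ∈ Finset.Ico c (2 * n), (arm W x / b + 3)
        = arm W c / b + 3 + ∑ x ∈ Finset.Ico (c + 1) (2 * n), (arm W x / b + 3) :=
      Finset.sum_eq_sum_Ico_succ_bot he _
    obtain ⟨X, hX⟩ : ∃ X, X = s'.arr 2 (c + r) := ⟨_, rfl⟩
    obtain ⟨Y, hY⟩ : ∃ Y, Y = s'.arr 3 (c - r) := ⟨_, rfl⟩
    by_cases hcont : r < n / 2 ∧ X = Y
    · -- the blocks agree
      have hFX := hF (c + r) (by omega)
      have hGY := hG (c - r) (by omega)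
      rw [← harr 2 (by norm_num), ← hX, show min b (3 * n - (c + r)) = b by omega] at hFX
      rw [← harr 3 (by norm_num), ← hY, show min b (c - r) = b by omega] at hGY
      have hmat' : Matches W c (r + b) :=
        (matches_add_iff_mod hmat (by omega) hFX.2 hGY.2 le_rfl).mpr (by rw [hcont.2])
      have hle := le_arm hmat (by omega)
      have hqle' : q ≤ arm W c / b := by
        rw [Nat.le_div_iff_mul_le (by omega), mul_comm, ← hq]; exact hle
      have hrb' : (r + b) / b = q + 1 := by
        rw [Nat.add_div_right _ (by omega), hrb]
      simp [Safe, exec, r₀, r₁, ← hc, ← hr, ← hX, ← hY, hcont.1, hcont.2]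
      refine ⟨by omega, ⟨⟨harr, hR0'⟩, ⟨hcn, hc2⟩, ⟨hmat', q + 1, by rw [hq]; ring, by omega⟩,
        hR, hhd, hnx⟩, ?_⟩
      rw [hrb', hrb, hsum]
      omega
    · -- the end of the drome is found
      have harm : n / 2 - (n / 2 - (r + s'.arr 1 (X - Y + (Y - X)))) = arm W c := by
        by_cases hlt : r < n / 2
        · have hne : X ≠ Y := fun h => hcont ⟨hlt, h⟩
          have hFX := hF (c + r) (by omega)
          have hGY := hG (c - r) (by omega)
          rw [← harr 2 (by norm_num), ← hX, show min b (3 * n - (c + r)) = b by omega] at hFX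
          rw [← harr 3 (by norm_num), ← hY, show min b (c - r) = b by omega] at hGY
          have hval := hT (X - Y + (Y - X)) (by omega) (by omega)
          rw [← harr 1 (by norm_num)] at hval
          have hvb : s'.arr 1 (X - Y + (Y - X)) < b := by
            have h₁ := Nat.le_of_dvd (by omega) hval.1
            have h₂ : 4 ^ s'.arr 1 (X - Y + (Y - X)) < 4 ^ b := by omega
            exact (Nat.pow_lt_pow_iff_right (by norm_num)).mp h₂
          rw [arm_eq_of_isVal hmat (by omega) hFX.2 hGY.2 hvb hval, hW]
          omega
        · have h₁ := le_arm (hmat.mono (show n / 2 ≤ r by omega)) (by omega)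
          have h₂ := two_mul_arm_le W c
          omega
      have hcond : (if r < n / 2 then 1 else 0) * (if X = Y then 1 else 0) = 0 := by
        by_cases h : r < n / 2
        · rw [if_neg fun h' => hcont ⟨h, h'⟩, mul_zero]
        · rw [if_neg h, zero_mul]
      have hkey : (c + arm W c) % n = endKey W c := by rw [endKey, hW]
      have hkeylt : endKey W c < n := by rw [← hkey]; exact Nat.mod_lt _ (by omega)
      have harmle := two_mul_arm_le W c
      have hhdle := lastBefore_le (endKey W) n (endKey W c) c
      simp only [Safe, exec, eval_mul, eval_less, eval_equal, eval_reg, eval_div, eval_const,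
        eval_arr, eval_add, eval_sub, eval_mod, r₀, ← hc, ← hr, ← hX, ← hY, hcond, ne_eq,
        not_true_eq_false, if_false, Memory.reg_setReg, Memory.arr_setReg, Memory.reg_setArr,
        Memory.arr_setArr, harm]
      simp [hkey, hhd, r₁]
      refine ⟨by omega, ⟨⟨fun k hk x => ?_, ?_⟩, ⟨by omega, he⟩,
        fun j hj => absurd hj (Nat.not_lt_zero j), fun x hx hx' => ?_, fun j => ?_,
        fun x hx hx' => ?_⟩, ?_⟩
      · rw [if_neg (by omega), if_neg (by omega), if_neg (by omega)]
        exact harr k hk x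
      · rw [if_neg (by omega)]
        exact hR0'
      · split_ifs with h
        · rw [h]
        · exact hR x hx (by omega)
      · rw [lastBefore_succ hcn]
        simp only [eq_comm]
      · split_ifs with h
        · rw [h]
        · exact hnx x hx (by omega)
      · rw [hrb, hsum]
        omega
  · rintro s' ⟨⟨⟨r₀, r₁, harr, hR0'⟩, ⟨hcn, hc2⟩, -, hR, hhd, hnx⟩, he⟩
    simp [r₀] at he
    have hc : s'.reg 3 = 2 * n := by omega
    rw [hc] at hR hhd hnx
    exact ⟨r₀, harr 0 (by norm_num), hR0', hR, hhd, hnx⟩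

/-! ### Computation of the maximal palindromes -/

/-- The factor `[s - e, e)` of `z`, whose ends add up to `s`, is a palindrome. -/
def PalTo (z : ℕ → ℕ) (s e : ℕ) : Prop := ∀ x y, x + y + 1 = s → x < e → y < e → z x = z y

/-- `[s - e, e)` is the longest palindrome within `[0, N)` whose ends add up to `s`. The bound
`s ≤ 2 * e` puts the left end at or before the right one. -/
structure IsPalEnd (z : ℕ → ℕ) (N s e : ℕ) : Prop where
  pal : PalTo z s e
  le : e ≤ s
  le_bound : e ≤ N
  le_two_mul : s ≤ 2 * e
  ne : e < N → e < s → z e ≠ z (s - 1 - e)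

section Manacher

variable {z : ℕ → ℕ} {N : ℕ}

lemma PalTo.mono {s e e' : ℕ} (h : PalTo z s e) (he : e' ≤ e) : PalTo z s e' :=
  fun x y hxy hx hy => h x y hxy (by omega) (by omega)

lemma PalTo.succ {s e : ℕ} (h : PalTo z s e) (he : z e = z (s - 1 - e)) : PalTo z s (e + 1) := by
  intro x y hxy hx hy
  by_cases hxe : x = e
  · rw [hxe, he]; congr 1; omega
  · by_cases hye : y = e
    · rw [hye, he]; congr 1; omega
    · exact h x y hxy (by omega) (by omega)

/-- A palindrome whose mirror image ends strictly inside a longer one is a mirror image itself. -/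
lemma IsPalEnd.mirror {s₀ e₀ s e' : ℕ} (h₀ : IsPalEnd z N s₀ e₀)
    (h' : IsPalEnd z N (2 * s₀ - s) e') (hs : s₀ < s) (hv : s - s₀ + e' < e₀) :
    IsPalEnd z N s (s - s₀ + e') := by
  obtain ⟨p₀, l₀, b₀, t₀, -⟩ := h₀
  obtain ⟨p', l', b', t', n'⟩ := h'
  have hs2 : s ≤ 2 * s₀ := by omega
  refine ⟨fun x y hxy hx hy => ?_, by omega, by omega, by omega, fun _ hlt => ?_⟩
  · rw [p₀ x (s₀ - 1 - x) (by omega) (by omega) (by omega),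
      p₀ y (s₀ - 1 - y) (by omega) (by omega) (by omega)]
    exact p' _ _ (by omega) (by omega) (by omega)
  · rw [p₀ (s - s₀ + e') (2 * s₀ - s - 1 - e') (by omega) (by omega) (by omega),
      p₀ (s - 1 - (s - s₀ + e')) e' (by omega) (by omega) (by omega)]
    exact (n' (by omega) (by omega)).symm

lemma IsPalEnd.palTo_of_le {s₀ e₀ s e' : ℕ} (h₀ : IsPalEnd z N s₀ e₀)
    (h' : IsPalEnd z N (2 * s₀ - s) e') (hs : s₀ < s) (hv : e₀ ≤ s - s₀ + e') :
    PalTo z s e₀ := by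
  obtain ⟨p₀, l₀, b₀, t₀, -⟩ := h₀
  obtain ⟨p', l', b', t', -⟩ := h'
  intro x y hxy hx hy
  rw [p₀ x (s₀ - 1 - x) (by omega) (by omega) (by omega),
    p₀ y (s₀ - 1 - y) (by omega) (by omega) (by omega)]
  exact p' _ _ (by omega) (by omega) (by omega)

lemma IsPalEnd.le_iff {s e d : ℕ} (h : IsPalEnd z N s e) (hs : d ≤ s) (hN : d ≤ N) :
    d ≤ e ↔ PalTo z s d := by
  refine ⟨fun hd => h.pal.mono hd, fun hd => ?_⟩
  by_contra hlt
  have := h.le_two_mul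
  exact h.ne (by omega) (by omega) (hd e (s - 1 - e) (by omega) (by omega) (by omega))

end Manacher

/-- Manacher's algorithm: computes in array `7`, for each sum `s < 3 n` of ends, the right end of
the longest palindrome within `[0, 2 n)`. Register `8` holds the current sum `s`, register `9` the
sum of the palindrome that reaches farthest to the right, register `10` the end that is being
extended. -/
def palProgram : Program :=
  .seq (.seq (.store 7 (const 0) (const 0))
      (.seq (.assign 8 (const 1)) (.seq (.assign 9 (const 0)) (.assign 10 (const 0)))))
    (.loop (less (reg 8) (const 3 * reg 0))
      (.ite (less (reg 8 - reg 9 + arr 7 (const 2 * reg 9 - reg 8)) (arr 7 (reg 9)))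
        (.seq (.store 7 (reg 8) (reg 8 - reg 9 + arr 7 (const 2 * reg 9 - reg 8)))
          (.assign 8 (reg 8 + const 1)))
        (.ite (less (reg 10) (const 2 * reg 0) * (less (reg 10) (reg 8) *
            equal (arr 0 (reg 10 % reg 0)) (arr 0 ((reg 8 - const 1 - reg 10) % reg 0))))
          (.assign 10 (reg 10 + const 1))
          (.seq (.store 7 (reg 8) (reg 10))
            (.seq (.assign 9 (reg 8)) (.assign 8 (reg 8 + const 1)))))))

lemma palProgram_spec {n M : ℕ} {s : Memory} {z : ℕ → ℕ} (hn : 4 ≤ n) (hM : 16 * n ≤ M)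
    (h₀ : s.reg 0 = n) (hz : ∀ i, s.arr 0 (i % n) = z i) :
    palProgram.Reaches M s (palProgram.phaseBound 5 * n) (fun s' =>
      s'.reg 0 = n ∧ (∀ k ≠ 7, ∀ x, s'.arr k x = s.arr k x) ∧
      (∀ i < 3 * n, IsPalEnd z (2 * n) i (s'.arr 7 i))) := by
  refine (Reaches.phase (C := 5) (fun s' =>
      (s'.reg 0 = n ∧ (∀ k ≠ 7, ∀ x, s'.arr k x = s.arr k x)) ∧
      (s'.reg 9 < s'.reg 8 ∧ s'.reg 8 ≤ 3 * n) ∧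
      (s'.reg 10 ≤ s'.reg 8 ∧ s'.reg 10 ≤ 2 * n ∧ s'.arr 7 (s'.reg 9) ≤ s'.reg 10 ∧
        s'.reg 8 ≤ 2 * s'.arr 7 (s'.reg 9) + 1) ∧
      (s'.reg 8 - s'.reg 9 + s'.arr 7 (2 * s'.reg 9 - s'.reg 8) < s'.arr 7 (s'.reg 9) →
        s'.reg 10 = s'.arr 7 (s'.reg 9)) ∧
      (s'.arr 7 (s'.reg 9) ≤ s'.reg 8 - s'.reg 9 + s'.arr 7 (2 * s'.reg 9 - s'.reg 8) →
        PalTo z (s'.reg 8) (s'.reg 10)) ∧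
      (∀ i < s'.reg 8, IsPalEnd z (2 * n) i (s'.arr 7 i)))
    (fun s' => (3 * n - s'.reg 8) + (2 * n - s'.reg 10)) (by omega) ?_ ?_ ?_ ?_).mono le_rfl ?_
  · simp [Safe]; omega
  · simp [exec, h₀]
    refine ⟨fun k hk x h => absurd h hk, by omega, ?_, ?_⟩
    · intro x y hxy hx; omega
    · exact ⟨fun x y _ hx => by omega, le_rfl, by omega, by omega, fun _ h => absurd h (by omega)⟩
  · simp [exec]; omega
  · rintro s' ⟨⟨r₀, harr⟩, ⟨h98, h83⟩, ⟨h108, h10n, hE10, h8E⟩, hin, hout, hE⟩ he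
    simp [r₀] at he
    have hin0 : ∀ i, s'.arr 0 (i % n) = z i := by intro i; rw [harr 0 (by norm_num), hz]
    obtain ⟨i, hi⟩ : ∃ i, i = s'.reg 8 := ⟨_, rfl⟩
    obtain ⟨i₀, hi₀⟩ : ∃ i₀, i₀ = s'.reg 9 := ⟨_, rfl⟩
    obtain ⟨e, hee⟩ : ∃ e, e = s'.reg 10 := ⟨_, rfl⟩
    rw [← hi, ← hi₀] at h98
    rw [← hi] at h83 he
    rw [← hi, ← hi₀, ← hee] at hin hout
    rw [← hi] at hE h108 h8E
    rw [← hee] at h108 h10n hE10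
    rw [← hi₀] at hE10 h8E
    have E₀ := hE i₀ h98
    have E' := hE (2 * i₀ - i) (by omega)
    -- the invariant for the next sum, once the palindrome for the current sum is known
    have next : ∀ (A : ℕ → ℕ) (j : ℕ), j < i + 1 → (∀ k < i + 1, IsPalEnd z (2 * n) k (A k)) →
        A j ≤ i + 1 - j + A (2 * j - (i + 1)) → PalTo z (i + 1) (A j) :=
      fun A j hj hA hle => (hA j hj).palTo_of_le (hA _ (by omega)) hj hle
    by_cases hv : i - i₀ + s'.arr 7 (2 * i₀ - i) < s'.arr 7 i₀
    · have hnew := E₀.mirror E' h98 hv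
      have h1 := hnew.le_two_mul
      have h2 := E₀.le_bound
      have hA : ∀ k < i + 1, IsPalEnd z (2 * n) k
          (if k = i then i - i₀ + s'.arr 7 (2 * i₀ - i) else s'.arr 7 k) := by
        intro k hk
        split_ifs with h
        · rw [h]; exact hnew
        · exact hE k (by omega)
      have hnext := next _ i₀ (by omega) hA
      rw [if_neg h98.ne] at hnext
      simp [Safe, exec, r₀, ← hi, ← hi₀, ← hee, hv, h98.ne, hin hv]
      refine ⟨by omega, ⟨fun k hk x => ?_, ⟨by omega, he⟩, by omega, hnext,
        fun k hk => hA k (by omega)⟩, by omega⟩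
      rw [if_neg hk]
      exact harr k hk x
    · by_cases hext : e < 2 * n ∧ e < i ∧ z e = z (i - 1 - e)
      · have hp := (hout (by omega)).succ hext.2.2
        simp [Safe, exec, r₀, ← hi, ← hi₀, ← hee, hv, hext.1, hext.2.1, hin0, hext.2.2]
        exact ⟨by omega, ⟨harr, ⟨h98, h83⟩, by omega, fun _ => hp, hE⟩, by omega⟩
      · have hcond : (if e < 2 * n then 1 else 0) * ((if e < i then 1 else 0) *
            (if z e = z (i - 1 - e) then 1 else 0)) = 0 := by
          split_ifs with c₁ c₂ c₃
          · exact absurd ⟨c₁, c₂, c₃⟩ hext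
          all_goals rfl
        have hnew : IsPalEnd z (2 * n) i e := by
          refine ⟨hout (by omega), h108, h10n, ?_, fun h1 h2 h3 => hext ⟨h1, h2, h3⟩⟩
          by_contra hcon
          exact hext ⟨by omega, by omega, by congr 1; omega⟩
        have hA : ∀ k < i + 1, IsPalEnd z (2 * n) k (if k = i then e else s'.arr 7 k) := by
          intro k hk
          split_ifs with h
          · rw [h]; exact hnew
          · exact hE k (by omega)
        have h1 := hnew.le_two_mul
        have hnext := next _ i (by omega) hA
        simp at hnext
        simp only [Safe, exec, eval_mul, eval_less, eval_equal, eval_reg, eval_const,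
          eval_arr, eval_add, eval_sub, eval_mod, r₀, ← hi, ← hi₀, ← hee, hv, hin0, hcond]
        simp [r₀, ← hi, ← hee]
        refine ⟨by omega, ⟨fun k hk x => ?_, he, by omega, hnext,
          fun k hk => hA k (by omega)⟩, by omega⟩
        rw [if_neg hk]
        exact harr k hk x
  · rintro s' ⟨⟨⟨r₀, harr⟩, ⟨h98, h83⟩, -, -, -, hE⟩, he⟩
    simp [r₀] at he
    exact ⟨r₀, harr, fun i hi => hE i (by omega)⟩

/-! ### Enumeration of the adjacent pairs -/

/-- The position, modulo `n`, where the maximal `90`-drome with centre `c` starts. -/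
noncomputable def startKey (W : List Letter) (c : ℕ) : ℕ := (c - arm W c) % W.length

/-- The centres in `[n, 2 n)` of the maximal `90`-dromes that end where the one with centre `c`
starts. -/
noncomputable def partners (W : List Letter) (c : ℕ) : Finset ℕ :=
  (Finset.Ico W.length (2 * W.length)).filter fun x => endKey W x = startKey W c

/-- The number of tests that remain when the pairs with second centre `c` and first centre at most
`p`, and those with greater second centres, are to be tested. -/
noncomputable def remaining (W : List Letter) (c p : ℕ) : ℕ :=
  if c < 2 * W.length then
    ∑ d ∈ Finset.Ico (c + 1) (2 * W.length), ((partners W d).card + 1)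
      + ((partners W c).filter (· ≤ p)).card + 1
  else 0

section Remaining

variable {W : List Letter}

lemma remaining_le_sum {c p : ℕ} : remaining W c p ≤
    ∑ d ∈ Finset.Ico c (2 * W.length), ((partners W d).card + 1) := by
  rw [remaining]
  split_ifs with h
  · rw [Finset.sum_eq_sum_Ico_succ_bot h]
    have := Finset.card_filter_le (partners W c) (· ≤ p)
    omega
  · exact Nat.zero_le _

lemma remaining_start_le (h2 : ∀ i, turn W i ≠ 2) (p : ℕ) :
    remaining W W.length p ≤ 1201 * W.length := by
  have h := sum_card_adjacent_le h2 (isArmFunction_arm W) (fun c => two_mul_arm_le W c)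
  refine remaining_le_sum.trans ?_
  rw [Finset.sum_add_distrib]
  have h₁ : ∑ c ∈ Finset.Ico W.length (2 * W.length), (partners W c).card ≤ 1200 * W.length := h
  have h₂ : ∑ _c ∈ Finset.Ico W.length (2 * W.length), 1 = W.length := by simp; omega
  omega

lemma remaining_succ_lt {c p p' : ℕ} (h : c < 2 * W.length) :
    remaining W (c + 1) p' < remaining W c p := by
  have := remaining_le_sum (W := W) (c := c + 1) (p := p')
  rw [remaining.eq_1 W c, if_pos h]
  omega

lemma remaining_lt_of_lt {c p p' : ℕ} (h : c < 2 * W.length) (hp : p ∈ partners W c)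
    (hlt : p' < p) : remaining W c p' < remaining W c p := by
  rw [remaining, remaining, if_pos h, if_pos h]
  have : ((partners W c).filter (· ≤ p')).card < ((partners W c).filter (· ≤ p)).card := by
    refine Finset.card_lt_card ⟨fun x hx => ?_, fun hcon => ?_⟩
    · rw [Finset.mem_filter] at hx ⊢
      exact ⟨hx.1, by omega⟩
    · have := hcon (Finset.mem_filter.mpr ⟨hp, le_rfl⟩)
      rw [Finset.mem_filter] at this
      omega
  omega

lemma palTo_codes_iff {k len : ℕ} :
    PalTo (codes W) (2 * k + len) (k + len) ↔ PalOn W k len := by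
  constructor
  · intro h j hj
    have := h (k + j) (k + len - 1 - j) (by omega) (by omega) (by omega)
    have := code_injective this
    rw [show ((k + j : ℕ) : ℤ) = k + j by push_cast; ring,
      show ((k + len - 1 - j : ℕ) : ℤ) = k + len - 1 - j by omega] at this
    exact this
  · intro h x y hxy hx hy
    have := h (x - k) (by omega)
    rw [show (k : ℤ) + (x - k : ℕ) = x by omega,
      show (k : ℤ) + len - 1 - (x - k : ℕ) = y by omega] at this
    rw [codes, codes, this]

lemma palOn_mod {k len : ℕ} : PalOn W (k % W.length : ℕ) len ↔ PalOn W k len := by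
  have h : (k : ℤ) = (k % W.length : ℕ) + W.length * (k / W.length : ℕ) := by
    exact_mod_cast (Nat.mod_add_div k W.length).symm
  rw [h, palOn_add_mul]

end Remaining

lemma pos_iff_of_le_one {f : ℕ} (hf : f ≤ 1) (A B C : Prop) [Decidable A] [Decidable B]
    [Decidable C] : 0 < f + (if A then 1 else 0) * (if B then 1 else 0) + (if C then 1 else 0) ↔
      f = 1 ∨ (A ∧ B) ∨ C := by
  by_cases hA : A <;> by_cases hB : B <;> by_cases hC : C <;> simp [hA, hB, hC] <;> omega

/-- Tests in turn every pair of a centre `c` (register `11`) and a centre `p` (register `12`) whose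
`90`-drome ends where the one of `c` starts, and once `p = 0`, which stands for an empty `90`-drome:
whether the rest of the circular word is a palindrome, and also whether the whole word from `c` on
is one. Register `13` tells whether a test has succeeded. -/
def pairProgram : Program :=
  .seq (.seq (.assign 11 (reg 0)) (.seq (.assign 12 (arr 5 ((reg 0 - arr 4 (reg 0)) % reg 0)))
      (.assign 13 (const 0))))
    (.loop (less (reg 11) (const 2 * reg 0))
      (.seq (.assign 14 ((reg 11 + arr 4 (reg 11)) % reg 0))
      (.seq (.assign 15 (reg 0 - const 2 * arr 4 (reg 11) - const 2 * arr 4 (reg 12)))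
      (.seq (.assign 13 (less (const 0) (reg 13 +
          less (const 2 * arr 4 (reg 11) + const 2 * arr 4 (reg 12)) (reg 0 + const 1) *
            less (reg 14 + reg 15) (arr 7 (const 2 * reg 14 + reg 15) + const 1) +
          less (reg 11) (arr 7 (const 2 * reg 11 - reg 0) + const 1))))
        (.ite (reg 12) (.assign 12 (arr 6 (reg 12)))
          (.seq (.assign 11 (reg 11 + const 1))
            (.assign 12 (arr 5 ((reg 11 - arr 4 (reg 11)) % reg 0)))))))))

lemma pairProgram_spec {W : List Letter} {n M : ℕ} {s : Memory} (h2 : ∀ i, turn W i ≠ 2)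
    (hW : W.length = n) (hn : 4 ≤ n) (hM : 16 * n ≤ M) (h₀ : s.reg 0 = n)
    (hR0 : s.arr 4 0 = 0) (hR : ∀ x, n ≤ x → x < 2 * n → s.arr 4 x = arm W x)
    (hhead : ∀ j, s.arr 5 j = lastBefore (endKey W) n j (2 * n))
    (hnext : ∀ x, n ≤ x → x < 2 * n → s.arr 6 x = lastBefore (endKey W) n (endKey W x) x)
    (hE : ∀ i < 3 * n, IsPalEnd (codes W) (2 * n) i (s.arr 7 i)) :
    pairProgram.Reaches M s (pairProgram.phaseBound 1201 * n) (fun s' =>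
      (HasQuarterTurnFactorization W → s'.reg 13 = 1) ∧
      (¬ HasQuarterTurnFactorization W → s'.reg 13 = 0)) := by
  classical
  have hiff := hasQuarterTurnFactorization_iff h2 (by omega) (R := s.arr 4)
    (fun c hc => by rw [Finset.mem_Ico, hW] at hc; exact hR c hc.1 hc.2) hR0
  rw [hW] at hiff
  have hstart : ∀ c, n ≤ c → c < 2 * n → (c - s.arr 4 c) % n = startKey W c := by
    intro c h h'; rw [hR c h h', startKey, hW]
  have hend : ∀ c, n ≤ c → c < 2 * n → (c + s.arr 4 c) % n = endKey W c := by
    intro c h h'; rw [hR c h h', endKey, hW]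
  have hmem : ∀ c x, x ∈ partners W c ↔ (n ≤ x ∧ x < 2 * n) ∧ endKey W x = startKey W c := by
    intro c x; rw [partners, Finset.mem_filter, Finset.mem_Ico, hW]
  -- the test for the pair of `c` and `x`
  set T : ℕ → ℕ → Prop := fun c x => 2 * s.arr 4 c + 2 * s.arr 4 x ≤ n ∧
    PalOn W (c + s.arr 4 c) (n - 2 * s.arr 4 c - 2 * s.arr 4 x) with hT
  have hlast : ∀ j c, lastBefore (endKey W) n j c = 0 ∨
      (n ≤ lastBefore (endKey W) n j c ∧ lastBefore (endKey W) n j c < c ∧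
        endKey W (lastBefore (endKey W) n j c) = j) := fun j c => by
    by_cases h : lastBefore (endKey W) n j c = 0
    · exact .inl h
    · exact .inr (lastBefore_mem h)
  refine (Reaches.phase (C := 1201) (fun s' =>
      (s'.reg 0 = n ∧ s'.arr = s.arr) ∧ (n ≤ s'.reg 11 ∧ s'.reg 11 ≤ 2 * n) ∧
      (s'.reg 11 < 2 * n → s'.reg 12 = 0 ∨ s'.reg 12 ∈ partners W (s'.reg 11)) ∧
      (s'.reg 13 ≤ 1 ∧ (s'.reg 13 ≠ 0 → HasQuarterTurnFactorization W)) ∧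
      (∀ c, n ≤ c → c < s'.reg 11 → PalOn W c n ∨ (∃ x, (x = 0 ∨ x ∈ partners W c) ∧ T c x) →
        s'.reg 13 = 1) ∧
      (s'.reg 11 < 2 * n → ∀ x ∈ partners W (s'.reg 11), s'.reg 12 < x → T (s'.reg 11) x →
        s'.reg 13 = 1))
    (fun s' => remaining W (s'.reg 11) (s'.reg 12)) (by omega) ?_ ?_ ?_ ?_).mono le_rfl ?_
  · have := lastBefore_le (endKey W) n ((n - s.arr 4 n) % n) (2 * n)
    simp [Safe, exec, h₀, hhead]; omega
  · simp [exec, h₀, hhead]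
    refine ⟨by omega, fun _ => ?_, fun c h h' => absurd h' (by omega), fun _ x hx hlt => ?_⟩
    · rw [hstart n le_rfl (by omega), hmem]
      exact (hlast (startKey W n) (2 * n)).imp id fun h => ⟨⟨h.1, h.2.1⟩, h.2.2⟩
    · rw [hstart n le_rfl (by omega)] at hlt
      rw [hmem] at hx
      have := le_lastBefore hx.1.1 hx.1.2 hx.2
      omega
  · have := remaining_start_le h2 (lastBefore (endKey W) n ((n - s.arr 4 n) % n) (2 * n))
    rw [hW] at this
    simpa [exec, h₀, hhead] using this
  · rintro s' ⟨⟨r₀, harr⟩, ⟨hnc, hc2⟩, hp, ⟨hf1, hsound⟩, hdone, hpart⟩ he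
    simp [r₀] at he
    obtain ⟨c, hc⟩ : ∃ c, c = s'.reg 11 := ⟨_, rfl⟩
    obtain ⟨p, hpe⟩ : ∃ p, p = s'.reg 12 := ⟨_, rfl⟩
    obtain ⟨f, hf⟩ : ∃ f, f = s'.reg 13 := ⟨_, rfl⟩
    rw [← hc] at hnc hc2 he
    rw [← hc, ← hpe] at hp
    rw [← hc, ← hf] at hdone
    rw [← hc, ← hpe, ← hf] at hpart
    rw [← hf] at hf1 hsound
    have hp' := hp he
    have hkn : endKey W c < n := by rw [endKey, hW]; exact Nat.mod_lt _ (by omega)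
    have hp2 : p < 2 * n := by
      rcases hp' with h | h
      · omega
      · exact ((hmem _ _).mp h).1.2
    have htest : ∀ len, len = n - 2 * s.arr 4 c - 2 * s.arr 4 p →
        (2 * s.arr 4 c + 2 * s.arr 4 p < n + 1 ∧
          endKey W c + len < s.arr 7 (2 * endKey W c + len) + 1 ↔ T c p) := by
      intro len hlen
      simp only [hT]
      rw [Nat.lt_succ_iff, Nat.lt_succ_iff, (hE _ (by omega)).le_iff (by omega) (by omega),
        palTo_codes_iff, ← hlen]
      have : PalOn W (c + s.arr 4 c) len ↔ PalOn W (endKey W c) len := by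
        rw [← hend c hnc he, ← hW, palOn_mod, Nat.cast_add]
      rw [this]
    have hwhole : c < s.arr 7 (2 * c - n) + 1 ↔ PalOn W c n := by
      rw [Nat.lt_succ_iff, (hE _ (by omega)).le_iff (by omega) (by omega)]
      have h₁ := palTo_codes_iff (W := W) (k := c - n) (len := n)
      rw [show 2 * (c - n) + n = 2 * c - n by omega, Nat.sub_add_cancel hnc] at h₁
      rw [h₁]
      have h₂ := palOn_add_mul (W := W) (c - n : ℕ) 1 n
      rw [hW, show ((c - n : ℕ) : ℤ) + n * 1 = c by omega] at h₂
      exact h₂.symm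
    -- the new value of the flag
    obtain ⟨f', hf'⟩ : ∃ f', f' = if 0 < f +
        (if 2 * s.arr 4 c + 2 * s.arr 4 p < n + 1 then 1 else 0) *
          (if endKey W c + (n - 2 * s.arr 4 c - 2 * s.arr 4 p) <
            s.arr 7 (2 * endKey W c + (n - 2 * s.arr 4 c - 2 * s.arr 4 p)) + 1 then 1 else 0) +
        (if c < s.arr 7 (2 * c - n) + 1 then 1 else 0) then 1 else 0 := ⟨_, rfl⟩
    have hflag : f' = if f = 1 ∨ T c p ∨ PalOn W c n then 1 else 0 := by
      rw [hf']
      refine if_congr ?_ rfl rfl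
      rw [pos_iff_of_le_one hf1, htest _ rfl, hwhole]
    have hf'1 : f' ≤ 1 := by rw [hflag]; split_ifs <;> omega
    have hsound' : f' ≠ 0 → HasQuarterTurnFactorization W := by
      intro hne
      have : f = 1 ∨ T c p ∨ PalOn W c n := by
        by_contra hcon
        rw [hflag, if_neg hcon] at hne
        exact hne rfl
      have hcI : c ∈ Finset.Ico n (2 * n) := Finset.mem_Ico.mpr ⟨hnc, he⟩
      rcases this with h | h | h
      · exact hsound (by omega)
      · refine hiff.mpr ⟨c, hcI, .inr ⟨p, ?_, h⟩⟩
        refine hp'.imp id fun hm => ?_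
        rw [hmem] at hm
        refine ⟨Finset.mem_Ico.mpr hm.1, ?_⟩
        rw [hend p hm.1.1 hm.1.2, hstart c hnc he]
        exact hm.2
      · exact hiff.mpr ⟨c, hcI, .inl h⟩
    have hmono : f = 1 → f' = 1 := fun h => by rw [hflag, if_pos (.inl h)]
    have hTp : T c p → f' = 1 := fun h => by rw [hflag, if_pos (.inr (.inl h))]
    have hPc : PalOn W c n → f' = 1 := fun h => by rw [hflag, if_pos (.inr (.inr h))]
    have hlen : n - 2 * s.arr 4 c - 2 * s.arr 4 p < M := by omega
    by_cases hp0 : p = 0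
    · have hb := lastBefore_le (endKey W) n ((c + 1 - s.arr 4 (c + 1)) % n) (2 * n)
      have hl := hlast ((c + 1 - s.arr 4 (c + 1)) % n) (2 * n)
      have hrem := remaining_succ_lt (W := W) (c := c) (p := p)
        (p' := lastBefore (endKey W) n ((c + 1 - s.arr 4 (c + 1)) % n) (2 * n)) (by omega)
      rw [hp0] at hf' hlen hrem hTp hpart
      simp +decide only [Safe, exec, eval_mul, eval_less, eval_reg, eval_const, eval_arr,
        eval_add, eval_sub, eval_mod, Memory.reg_setReg, Memory.arr_setReg, r₀, harr, ← hc, ← hpe,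
        ← hf, hend c hnc he, ← hf', hp0, if_true, if_false, ne_eq, hhead]
      refine ⟨⟨by omega, hlen, by omega, by omega, by omega⟩, ⟨trivial, by omega, fun hlt => ?_,
        ⟨hf'1, hsound'⟩, fun d hd hdc h => ?_, fun hlt x hx hxlt => ?_⟩, hrem⟩
      · rw [hstart (c + 1) (by omega) hlt] at hl ⊢
        rw [hmem]
        exact hl.imp id fun h => ⟨⟨h.1, h.2.1⟩, h.2.2⟩
      · by_cases hdc' : d = c
        · rw [hdc'] at h
          rcases h with h | ⟨x, rfl | hx, hxT⟩
          · exact hPc h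
          · exact hTp hxT
          · have := ((hmem _ _).mp hx).1.1
            exact hmono (hpart he x hx (by omega) hxT)
        · exact hmono (hdone d hd (by omega) h)
      · rw [hstart (c + 1) (by omega) hlt] at hxlt
        rw [hmem] at hx
        have := le_lastBefore hx.1.1 hx.1.2 hx.2
        omega
    · have hpm : p ∈ partners W c := hp'.resolve_left hp0
      have hpm' := (hmem _ _).mp hpm
      have hnx : s.arr 6 p = lastBefore (endKey W) n (startKey W c) p := by
        rw [hnext p hpm'.1.1 hpm'.1.2, hpm'.2]
      have hl := hlast (startKey W c) p
      have hrem := remaining_lt_of_lt (p' := s.arr 6 p) (by omega) hpm (by omega)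
      simp +decide only [Safe, exec, eval_mul, eval_less, eval_reg, eval_const, eval_arr,
        eval_add, eval_sub, eval_mod, Memory.reg_setReg, Memory.arr_setReg, r₀, harr, ← hc, ← hpe,
        ← hf, hend c hnc he, ← hf', hp0, if_true, if_false, ne_eq,
        not_false_eq_true, hhead]
      refine ⟨⟨by omega, hlen, by omega, by omega⟩, ⟨trivial, by omega, fun _ => ?_,
        ⟨hf'1, hsound'⟩, fun d hd hdc h => hmono (hdone d hd hdc h), fun _ x hx hxlt hxT => ?_⟩,
        hrem⟩
      · rw [hnx, hmem]
        refine hl.imp id fun h => ⟨⟨h.1, by omega⟩, h.2.2⟩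
      · rcases lt_trichotomy x p with h | h | h
        · have hx' := (hmem _ _).mp hx
          have := le_lastBefore hx'.1.1 h hx'.2
          omega
        · rw [h] at hxT
          exact hTp hxT
        · exact hmono (hpart he x hx h hxT)
  · rintro s' ⟨⟨⟨r₀, harr⟩, ⟨hnc, hc2⟩, -, ⟨hf1, hsound⟩, hdone, -⟩, he⟩
    have hc : s'.reg 11 = 2 * n := by
      by_contra hcon
      simp [r₀] at he
      omega
    have hcomplete : HasQuarterTurnFactorization W → s'.reg 13 = 1 := by
      intro hW'
      obtain ⟨c, hcI, h⟩ := hiff.mp hW'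
      rw [Finset.mem_Ico] at hcI
      refine hdone c hcI.1 (by omega) (h.imp id ?_)
      rintro ⟨x, hx, hx'⟩
      refine ⟨x, hx.imp id fun ⟨hxI, hxe⟩ => ?_, hx'⟩
      rw [Finset.mem_Ico] at hxI
      rw [hmem, ← hend x hxI.1 hxI.2, ← hstart c hcI.1 hcI.2]
      exact ⟨hxI, hxe⟩
    refine ⟨hcomplete, fun hno => ?_⟩
    by_contra hne
    exact hno (hsound hne)

/-! ### The complete program -/

/-- The program that decides whether a circular word without backtracking has a quarter-turn
factorization. -/
def quarterTurnProgram : Program :=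
  .seq blockProgram (.seq tableProgram (.seq packProgram (.seq armProgram (.seq palProgram
    (.seq pairProgram (.assign 0 (reg 13)))))))

lemma input_arr_zero {W : List Letter} (hW : 0 < W.length) (i : ℕ) :
    (input W).arr 0 (i % W.length) = codes W i := by
  have h : i % W.length < W.length := Nat.mod_lt _ hW
  have e : (((i : ℤ) % (W.length : ℤ)).toNat) = i % W.length := by
    rw [← Int.natCast_mod, Int.toNat_natCast]
  simp [input, codes, cyc, e, h]

theorem quarterTurnProgram_spec : ∃ K, ∀ W : List Letter, (∀ i, turn W i ≠ 2) → 4 ≤ W.length →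
    quarterTurnProgram.Reaches (W.length ^ 3) (input W) (K * W.length) (fun s =>
      (HasQuarterTurnFactorization W → s.reg 0 = 1) ∧
      (¬ HasQuarterTurnFactorization W → s.reg 0 = 0)) := by
  refine ⟨blockProgram.phaseBound 1 + (tableProgram.phaseBound 1 + (packProgram.phaseBound 3 +
    (armProgram.phaseBound 51 + (palProgram.phaseBound 5 + (pairProgram.phaseBound 1201 +
      (Program.assign 0 (reg 13)).maxCost))))), fun W h2 hn => ?_⟩
  obtain ⟨n, hW⟩ : ∃ n, W.length = n := ⟨_, rfl⟩
  rw [hW] at hn ⊢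
  -- all numbers that are written are less than `16 n`, which is at most `n ^ 3` for `4 ≤ n`
  have hM : 16 * n ≤ n ^ 3 := by nlinarith [Nat.mul_le_mul hn hn]
  have hin : ∀ i, (input W).arr 0 (i % n) = codes W i := by
    rw [← hW]; exact input_arr_zero (by omega)
  have hcost : (Program.assign 0 (reg 13)).maxCost ≤ (Program.assign 0 (reg 13)).maxCost * n :=
    Nat.le_mul_of_pos_right _ (by omega)
  refine Reaches.mono (P := fun s => (HasQuarterTurnFactorization W → s.reg 0 = 1) ∧
      (¬ HasQuarterTurnFactorization W → s.reg 0 = 0)) (T := blockProgram.phaseBound 1 * n +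
    (tableProgram.phaseBound 1 * n + (packProgram.phaseBound 3 * n +
    (armProgram.phaseBound 51 * n + (palProgram.phaseBound 5 * n +
    (pairProgram.phaseBound 1201 * n + (Program.assign 0 (reg 13)).maxCost)))))) ?_
    (by simp only [add_mul]; omega) fun _ h => h
  refine (blockProgram_spec (by omega) hM (by simp [input, hW])).seq ?_
  rintro s₁ ⟨a₀, aarr, a₂, ale, alt⟩
  have hb : 1 ≤ s₁.reg 1 := by
    by_contra h
    rw [show s₁.reg 1 = 0 by omega] at a₂
    omega
  refine (tableProgram_spec (by omega) hM (by omega)).seq ?_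
  rintro s₂ ⟨breg, barr, bval⟩
  have b₀ := breg 0 (by norm_num)
  have b₁ := breg 1 (by norm_num)
  have b₂ := breg 2 (by norm_num)
  refine (packProgram_spec (b := s₁.reg 1) (a := codes W) (by omega) hM (by omega) (by omega) hb
    (by omega) (fun i => by rw [barr 0 (by norm_num), aarr, hin])
    (fun i => code_lt_four _)).seq ?_
  rintro s₃ ⟨creg, carr, cG, cF⟩
  have c₀ := creg 0 (by norm_num)
  have c₁ := creg 1 (by norm_num)
  refine (armProgram_spec (b := s₁.reg 1) h2 hW hn hM (by omega) (by omega) hb (by omega)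
    (by omega) (fun x hx hx' => ?_) cG cF ?_ (fun j => ?_)).seq ?_
  · rw [carr 1 (by norm_num) (by norm_num)]
    exact bval x hx (by omega)
  · rw [carr 4 (by norm_num) (by norm_num), barr 4 (by norm_num), aarr]
    simp [input]
  · rw [carr 5 (by norm_num) (by norm_num), barr 5 (by norm_num), aarr]
    simp [input]
  rintro s₄ ⟨d₀, darr, dR0, dR, dhd, dnx⟩
  refine (palProgram_spec (z := codes W) hn hM d₀ (fun i => ?_)).seq ?_
  · rw [darr, carr 0 (by norm_num) (by norm_num), barr 0 (by norm_num), aarr, hin]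
  rintro s₅ ⟨e₀, earr, eE⟩
  refine (pairProgram_spec h2 hW hn hM e₀ (by rw [earr 4 (by norm_num), dR0])
    (fun x h h' => by rw [earr 4 (by norm_num), dR x h h'])
    (fun j => by rw [earr 5 (by norm_num), dhd])
    (fun x h h' => by rw [earr 6 (by norm_num), dnx x h h']) eE).seq ?_
  rintro s₆ ⟨hyes, hno⟩
  refine Reaches.of_safe ?_ ?_
  · simp only [Safe, eval_reg]
    by_cases h : HasQuarterTurnFactorization W
    · rw [hyes h]; omega
    · rw [hno h]; omega
  · simpa [exec] using ⟨hyes, hno⟩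

end QuarterTurn

theorem mainTheorem4 :
    ∃ (prog : QuarterTurn.Program) (K k : ℕ),
      ∀ (P : QuarterTurn.Polyomino) (W : List QuarterTurn.Letter), P.IsBoundaryWord W →
        ∃ (t : ℕ) (s : QuarterTurn.Memory),
          QuarterTurn.Runs (W.length ^ k) prog (QuarterTurn.input W) t s ∧
          t ≤ K * W.length ∧
          (QuarterTurn.HasQuarterTurnFactorization W → s.reg 0 = 1) ∧
          (¬ QuarterTurn.HasQuarterTurnFactorization W → s.reg 0 = 0) := by
  obtain ⟨K, hK⟩ := QuarterTurn.quarterTurnProgram_spec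
  exact ⟨QuarterTurn.quarterTurnProgram, K, 3, fun P W h =>
    hK W h.turn_ne_two h.four_le_length⟩
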